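/- Let $\mathcal X$ be a measurable space, $n,c,t,B\ge 1$ integers, and $\mathcal F$ a finite nonempty class of measurable functions $\mathcal X\to\{0,1\}$. A dataset is $D=(X_i,y_i)_{i=1}^n$ with $X_i\in\mathcal X$, $y_i\in[c]$. For a decision tree $T$ with node functions in $\mathcal F$ let $w(l)$ be the number of points of $D$ mapped to the leaf $l$ and $p_i(l)$ the fraction of them labelled $i$; leaves are labelled by their most frequent label, $L(T,D)=\frac1n\sum_{i=1}^n\mathbf 1[T(X_i)\ne y_i]$. For $\alpha>0$, $\beta\in[B]$ let $$g_{\alpha,\beta}(p)=\frac{\kappa}{\alpha-1}\Big(1-\Big(\sum_{i=1}^c p_i^\alpha\Big)^\beta\Big)\ (\alpha\neq1),\qquad g_{1,\beta}(p)=-\kappa\beta\sum_{i=1}^c p_i\log p_i,$$ with a constant $\kappa>0$ (the $(\alpha,\beta)$-Tsallis entropy). Starting from a single leaf, the top-down learner performs $t$ splits, each time choosing a leaf $l$ and $f\in\mathcal F$ minimizing $\sum_{l'}w(l')\,g_{\alpha,\beta}(p(l'))$, summed over the leaves of the tree obtained by splitting $l$ with $f$. The grown tree is then replaced by a pruned subtree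 $T=T_{\alpha,\beta,\tilde\alpha}(D)$ which minimizes $L(T',D)+\tilde\alpha\,|\mathrm{leaves}(T')|$ over all pruned subtrees $T'$ (min cost-complexity pruning, $\tilde\alpha\ge0$). Ties are resolved by fixed rules that do not depend on the data or on $\alpha,\beta$ (the pruning rule may depend on $\tilde\alpha$ and on the unpruned tree). For $\eta\ge0$ put $$\ell_{\alpha,\beta,\tilde\alpha}(D)=L\big(T_{\alpha,\beta,\tilde\alpha}(D),D\big)+\eta\,\big|\mathrm{leaves}\big(T_{\alpha,\beta,\tilde\alpha}(D)\big)\big|,\qquad L_\eta(\alpha,\beta,\tilde\alpha)=\mathbb E_{D\sim\mathcal D}\,\ell_{\alpha,\beta,\tilde\alpha}(D),$$ where $\mathcal D$ is a probability distribution over datasets, and let $H=1+\eta t$, the length of the interval $[\eta,1+\eta(t+1)]$ which contains the values of $\ell$. **Theorem.** There is a universal constant $K>0$ such that, for all data as above, each $\ell_{\alpha,\beta,\tilde\alpha}$ is $\mathcal D$-integrable, every sample of datasets has an empirical risk minimizer, and for all $\epsilon,\delta>0$ and every integer $$N\ \ge\ K\,\Big(\frac{H}{\epsilon}\Big)^2\Big(t\big(\log|\mathcal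 F|+\log t+c\log(B+c)\big)+\log\frac1\delta\Big)$$ the following holds with probability at least $1-\delta$ over independent $D_1,\dots,D_N\sim\mathcal D$: every empirical risk minimizer $(\hat\alpha,\hat\beta,\hat{\tilde\alpha})\in\operatorname{argmin}_{\alpha>0,\,\beta\in[B],\,\tilde\alpha\ge0}\sum_{j=1}^N\ell_{\alpha,\beta,\tilde\alpha}(D_j)$ satisfies $$L_\eta(\hat\alpha,\hat\beta,\hat{\tilde\alpha})\le \inf_{\alpha>0,\,\beta\in[B],\,\tilde\alpha\ge0}L_\eta(\alpha,\beta,\tilde\alpha)+\epsilon .$$ -/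

import Mathlib

open MeasureTheory

namespace TreeTuning

/-- A (binary) decision tree over the domain `X`: every internal node carries a boolean node
function. Class labels of leaves are not stored: they are computed from a dataset. -/
inductive DTree (X : Type*) where
  | leaf : DTree X
  | node (f : X → Bool) (l r : DTree X) : DTree X

namespace DTree

variable {X : Type*}

/-- The leaf which `x` is mapped to, as a root-to-leaf path (`false` is left, `true` is right). -/
def route : DTree X → X → List Bool
  | leaf, _ => []
  | node f l r, x => if f x = true then true :: r.route x else false :: l.route x

/-- The leaves of a tree, as root-to-leaf paths. -/
def leaves : DTree X → Finset (List Bool)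
  | leaf => {[]}
  | node _ l r => l.leaves.image (List.cons false) ∪ r.leaves.image (List.cons true)

/-- `|leaves(T)|`. -/
def numLeaves (T : DTree X) : ℕ := T.leaves.card

/-- `T_{p → f}`: the leaf `p` is replaced by an internal node labelled `f` with two leaf children
(the tree is unchanged if `p` is not a leaf). -/
def splitLeaf : DTree X → List Bool → (X → Bool) → DTree X
  | leaf, [], f => node f leaf leaf
  | leaf, _ :: _, _ => leaf
  | node g l r, [], _ => node g l r
  | node g l r, false :: p, f => node g (l.splitLeaf p f) r
  | node g l r, true :: p, f => node g l (r.splitLeaf p f)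

open Classical in
/-- The pruned subtrees of a tree: any set of branches is collapsed to leaves. -/
noncomputable def prunings : DTree X → Finset (DTree X)
  | leaf => {leaf}
  | node f l r => insert leaf (Finset.image₂ (node f) l.prunings r.prunings)

end DTree

/-- A dataset of `n` points of `X`, labelled by `c` classes. -/
abbrev Dataset (X : Type*) (n c : ℕ) : Type _ := Fin n → X × Fin c

/-- The rules by which the learner resolves the ties which are left open by "most frequent label",
by the argmin of the top-down learner and by "a subtree minimizing the cost-complexity".
They are fixed in advance: they see neither the dataset nor the splitting parameters. -/
structure TieBreaking (X : Type*) (c : ℕ) where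
  /-- Selects a label among the most frequent ones. -/
  label : Finset (Fin c) → Fin c
  /-- Selects a pair (leaf, node function) among the minimizers; it may depend on the current
  tree. -/
  split : DTree X → Finset (List Bool × (X → Bool)) → List Bool × (X → Bool)
  /-- Selects a pruned subtree among the minimizers; it may depend on the complexity parameter and
  on the unpruned tree. -/
  prune : ℝ → DTree X → Finset (DTree X) → DTree X
  label_mem : ∀ S : Finset (Fin c), S.Nonempty → label S ∈ S
  split_mem : ∀ T S, S.Nonempty → split T S ∈ S
  prune_mem : ∀ a T S, S.Nonempty → prune a T S ∈ S

/-- The `(α, β)`-Tsallis entropy with normalizing constant `κ`; at `α = 1` it is the limit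
`α → 1`, that is `-κ β ∑ p_i log p_i`. -/
noncomputable def tsallis {c : ℕ} (κ α : ℝ) (β : ℕ) (p : Fin c → ℝ) : ℝ :=
  if α = 1 then κ * β * ∑ i, Real.negMulLog (p i)
  else κ / (α - 1) * (1 - (∑ i, p i ^ α) ^ β)

section Learner

variable {X : Type*} {n c : ℕ}

/-- The weight `w(p)`: the number of data points which are mapped to the leaf `p`. -/
def weight (T : DTree X) (D : Dataset X n c) (p : List Bool) : ℕ :=
  (Finset.univ.filter fun i => T.route (D i).1 = p).card

/-- The number of data points with label `k` which are mapped to the leaf `p`. -/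
def labelCount (T : DTree X) (D : Dataset X n c) (p : List Bool) (k : Fin c) : ℕ :=
  (Finset.univ.filter fun i => T.route (D i).1 = p ∧ (D i).2 = k).card

/-- The splitting function `G(T) = ∑_{p ∈ leaves(T)} w(p) g({p_k(p)}_k)`, where `p_k(p)` is the
fraction of points labelled `k` among the points mapped to `p` (empty leaves contribute `0`). -/
noncomputable def splitFn (g : (Fin c → ℝ) → ℝ) (T : DTree X) (D : Dataset X n c) : ℝ :=
  ∑ p ∈ T.leaves,
    (weight T D p : ℝ) * g (fun k => (labelCount T D p k : ℝ) / (weight T D p : ℝ))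

open Classical in
/-- The pairs (leaf, node function) at which `G(T_{p → f})` is minimal. -/
noncomputable def bestSplits (g : (Fin c → ℝ) → ℝ) (F : Finset (X → Bool)) (T : DTree X)
    (D : Dataset X n c) : Finset (List Bool × (X → Bool)) :=
  (T.leaves ×ˢ F).filter fun q => ∀ q' ∈ T.leaves ×ˢ F,
    splitFn g (T.splitLeaf q.1 q.2) D ≤ splitFn g (T.splitLeaf q'.1 q'.2) D

/-- The top-down decision tree learner: start from a single leaf and split `t` times. -/
noncomputable def grow (tb : TieBreaking X c) (g : (Fin c → ℝ) → ℝ) (F : Finset (X → Bool))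
    (D : Dataset X n c) : ℕ → DTree X
  | 0 => DTree.leaf
  | t + 1 =>
    let T := grow tb g F D t
    let q := tb.split T (bestSplits g F T D)
    T.splitLeaf q.1 q.2

/-- The most frequent labels at a leaf. -/
def modes (T : DTree X) (D : Dataset X n c) (p : List Bool) : Finset (Fin c) :=
  Finset.univ.filter fun k => ∀ k', labelCount T D p k' ≤ labelCount T D p k

/-- The prediction `T(x)`, where each leaf of `T` is labelled by its most frequent label in `D`. -/
def predict (tb : TieBreaking X c) (T : DTree X) (D : Dataset X n c) (x : X) : Fin c :=
  tb.label (modes T D (T.route x))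

/-- The 0-1 loss `L(T, D)`. -/
noncomputable def loss (tb : TieBreaking X c) (T : DTree X) (D : Dataset X n c) : ℝ :=
  (1 / (n : ℝ)) * ∑ i, if predict tb T D (D i).1 ≠ (D i).2 then 1 else 0

/-- `L(T, D) + a |leaves(T)|`: the cost-complexity function with complexity parameter `a`. -/
noncomputable def penalizedLoss (tb : TieBreaking X c) (a : ℝ) (T : DTree X)
    (D : Dataset X n c) : ℝ :=
  loss tb T D + a * (T.numLeaves : ℝ)

open Classical in
/-- The pruned subtrees of `T` which minimize the cost-complexity function. -/
noncomputable def bestPrunings (tb : TieBreaking X c) (a : ℝ) (T : DTree X) (D : Dataset X n c) :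
    Finset (DTree X) :=
  T.prunings.filter fun T' => ∀ T'' ∈ T.prunings,
    penalizedLoss tb a T' D ≤ penalizedLoss tb a T'' D

/-- Minimum cost-complexity pruning with complexity parameter `a`. -/
noncomputable def mccPrune (tb : TieBreaking X c) (a : ℝ) (T : DTree X) (D : Dataset X n c) :
    DTree X :=
  tb.prune a T (bestPrunings tb a T D)

end Learner

/-- The tuned parameters: `α`, `β` of the splitting criterion, and the pruning parameter. -/
structure Params where
  α : ℝ
  β : ℕ
  αPrune : ℝ

/-- The parameter space `α > 0`, `β ∈ {1, …, B}`, `αPrune ≥ 0`. -/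
def Params.Admissible (B : ℕ) (ρ : Params) : Prop :=
  0 < ρ.α ∧ (1 ≤ ρ.β ∧ ρ.β ≤ B) ∧ 0 ≤ ρ.αPrune

section Tuning

variable {X : Type*} {n c : ℕ}

/-- The tree learned from `D`: grow with `t` splits by the `(α, β)`-Tsallis criterion, then
prune. -/
noncomputable def learnedTree (tb : TieBreaking X c) (κ : ℝ) (F : Finset (X → Bool)) (t : ℕ)
    (ρ : Params) (D : Dataset X n c) : DTree X :=
  mccPrune tb ρ.αPrune (grow tb (tsallis κ ρ.α ρ.β) F D t) D

/-- `L(T, D) + η |leaves(T)|` for the tree `T` learned from `D` with parameters `ρ`. -/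
noncomputable def objective (tb : TieBreaking X c) (κ : ℝ) (F : Finset (X → Bool)) (t : ℕ)
    (η : ℝ) (ρ : Params) (D : Dataset X n c) : ℝ :=
  penalizedLoss tb η (learnedTree tb κ F t ρ D) D

/-- `L_η(ρ)`: the expected objective under the distribution `μ` over datasets. -/
noncomputable def risk [MeasurableSpace X] (tb : TieBreaking X c) (κ : ℝ) (F : Finset (X → Bool))
    (t : ℕ) (η : ℝ) (μ : Measure (Dataset X n c)) (ρ : Params) : ℝ :=
  ∫ D, objective tb κ F t η ρ D ∂μ

/-- `ρ` is a possible output of empirical risk minimization on the sample `S` of datasets. -/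
def IsERM (tb : TieBreaking X c) (κ : ℝ) (F : Finset (X → Bool)) (t : ℕ) (η : ℝ) (B : ℕ) {N : ℕ}
    (S : Fin N → Dataset X n c) (ρ : Params) : Prop :=
  ρ.Admissible B ∧ ∀ ρ' : Params, ρ'.Admissible B →
    ∑ j, objective tb κ F t η ρ (S j) ≤ ∑ j, objective tb κ F t η ρ' (S j)

end Tuning

end TreeTuning

/-! For a fixed dataset the objective is piecewise constant in the parameters. The grown tree
depends on `α` only through comparisons of splitting functions of reachable trees. After removing
the factor `κ / (α - 1)`, such a comparison is the sign of a sum of powers `u ^ α`, expanded by the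
multinomial theorem, and by Rolle such a sum has at most as many zeros as terms
(`exists_breakpoints_grow`). Pruning compares affine functions of the complexity parameter, so it
too has finitely many breakpoints (`exists_breakpoints_mccPrune`). Both counts are at most `M = (t
|F| (B + c) ^ c) ^ (13 t)`.

Few breakpoints per dataset give small nets under the data distribution. Cutting the line at the
levels of the expected number of breakpoints to the left of `x` yields polynomially many cells in `M
/ γ`, each cut by a random breakpoint with probability `O(γ)` (`exists_cells`). Off that event the
objective is constant on the cell.

Since the exceptional event depends only on the cell, its indicator dominates the approximation
error. Chaining over the scales `γ = 8 ^ (-k)` with Bernstein-type bounds then gives uniform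
deviations `ε` from `O((log M + log (1 / δ)) / ε ^ 2)` samples, with no extra `log (1 / ε)`
(`HasNets.uniform_deviation`). Uniform deviation gives the claim for empirical risk minimizers.

Measurability is no issue: the learner sees a dataset only through its labels and the values of the
functions in `F`, so all probability takes place on a finite space (`Indist.objective_eq`). -/

namespace TreeTuning

/-! ### Exponential tail bounds on a finite probability space. -/

section Concentration

variable {Ω : Type*} [MeasurableSpace Ω] (ν : Measure Ω)

/-- The deviation of the sum of `Z` over a sample from its mean. -/
noncomputable def deviation {N : ℕ} (Z : Ω → ℝ) (S : Fin N → Ω) : ℝ :=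
  ∑ j, Z (S j) - N * ∫ ω, Z ω ∂ν

lemma deviation_neg {N : ℕ} (Z : Ω → ℝ) (S : Fin N → Ω) :
    deviation ν (fun ω => - Z ω) S = - deviation ν Z S := by
  simp only [deviation, Finset.sum_neg_distrib, integral_neg]
  ring

variable [Finite Ω] [MeasurableSingletonClass Ω] [IsProbabilityMeasure ν]

/-- A one-sided Bernstein-type tail bound for a sample of size `N`. -/
lemma measureReal_sum_ge_le {Z : Ω → ℝ} (hZ : ∀ ω, |Z ω| ≤ 1) {v l : ℝ}
    (hv : ∫ ω, Z ω ^ 2 ∂ν ≤ v) (hl0 : 0 ≤ l) (hl1 : l ≤ 1) (N : ℕ) (s : ℝ) :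
    (Measure.pi fun _ : Fin N => ν).real {S | s ≤ ∑ j, Z (S j) - N * ∫ ω, Z ω ∂ν}
      ≤ Real.exp (N * (l ^ 2 * v) - l * s) := by
  set e := ∫ ω, Z ω ∂ν with he
  have h1 : ∫ ω, Real.exp (l * (Z ω - e)) ∂ν ≤ Real.exp (l ^ 2 * v) := by
    -- From `e ^ x ≤ 1 + x + x ^ 2` for `|x| ≤ 1`; this is why `l ≤ 1` is required.
    have h2 : ∫ ω, Real.exp (l * Z ω) ∂ν ≤ 1 + l * e + l ^ 2 * v := by
      calc ∫ ω, Real.exp (l * Z ω) ∂ν ≤ ∫ ω, (1 + l * Z ω + l ^ 2 * Z ω ^ 2) ∂ν := by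
            refine integral_mono (.of_finite) (.of_finite) fun ω => ?_
            have h3 : |l * Z ω| ≤ 1 := by
              rw [abs_mul, abs_of_nonneg hl0]
              exact mul_le_one₀ hl1 (abs_nonneg _) (hZ ω)
            have := (abs_le.1 (Real.abs_exp_sub_one_sub_id_le h3)).2
            dsimp only
            nlinarith
        _ = 1 + l * e + l ^ 2 * ∫ ω, Z ω ^ 2 ∂ν := by
            rw [integral_add (.of_finite) (.of_finite), integral_add (.of_finite) (.of_finite),
              integral_const_mul, integral_const_mul]
            simp [he]
        _ ≤ _ := by gcongr
    calc ∫ ω, Real.exp (l * (Z ω - e)) ∂ν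
        = Real.exp (-(l * e)) * ∫ ω, Real.exp (l * Z ω) ∂ν := by
          rw [← integral_const_mul]
          refine integral_congr_ae (.of_forall fun ω => ?_)
          dsimp only
          rw [← Real.exp_add]; ring_nf
      _ ≤ Real.exp (-(l * e)) * Real.exp (l * e + l ^ 2 * v) := by
          gcongr
          have := Real.add_one_le_exp (l * e + l ^ 2 * v)
          linarith
      _ = _ := by rw [← Real.exp_add]; ring_nf
  have h4 : ∫ S : Fin N → Ω, Real.exp (l * (∑ j, Z (S j) - N * e))
      ∂(Measure.pi fun _ : Fin N => ν) ≤ Real.exp (N * (l ^ 2 * v)) := by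
    calc _ = ∫ S : Fin N → Ω, ∏ j, Real.exp (l * (Z (S j) - e))
            ∂(Measure.pi fun _ : Fin N => ν) := by
          refine integral_congr_ae (.of_forall fun S => ?_)
          dsimp only
          rw [← Real.exp_sum, ← Finset.mul_sum, Finset.sum_sub_distrib]
          simp
      _ = ∏ _j : Fin N, ∫ ω, Real.exp (l * (Z ω - e)) ∂ν :=
          integral_fintype_prod_eq_prod (𝕜 := ℝ) (μ := fun _ : Fin N => ν)
            (fun _ ω => Real.exp (l * (Z ω - e)))
      _ ≤ ∏ _j : Fin N, Real.exp (l ^ 2 * v) :=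
          Finset.prod_le_prod (fun _ _ => integral_nonneg fun _ => (Real.exp_pos _).le)
            fun _ _ => h1
      _ = _ := by simp [← Real.exp_nat_mul]
  have h5 := mul_meas_ge_le_integral_of_nonneg (μ := Measure.pi fun _ : Fin N => ν)
    (f := fun S => Real.exp (l * (∑ j, Z (S j) - N * e)))
    (.of_forall fun _ => (Real.exp_pos _).le) (.of_finite) (Real.exp (l * s))
  have h6 : {S : Fin N → Ω | s ≤ ∑ j, Z (S j) - N * e} ⊆
      {S | Real.exp (l * s) ≤ Real.exp (l * (∑ j, Z (S j) - N * e))} := fun S hS =>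
    Real.exp_le_exp.2 (mul_le_mul_of_nonneg_left hS hl0)
  rw [sub_eq_add_neg, Real.exp_add, Real.exp_neg, ← div_eq_mul_inv, le_div_iff₀ (Real.exp_pos _),
    mul_comm]
  exact (mul_le_mul_of_nonneg_left (measureReal_mono h6) (Real.exp_pos _).le).trans (h5.trans h4)

lemma deviation_add {N : ℕ} (Y Z : Ω → ℝ) (S : Fin N → Ω) :
    deviation ν (fun ω => Y ω + Z ω) S = deviation ν Y S + deviation ν Z S := by
  simp only [deviation, Finset.sum_add_distrib, integral_add (.of_finite : Integrable Y ν)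
    (.of_finite : Integrable Z ν)]
  ring

lemma measureReal_abs_deviation_ge_le {Z : Ω → ℝ} (hZ : ∀ ω, |Z ω| ≤ 1) {v l : ℝ}
    (hv : ∫ ω, Z ω ^ 2 ∂ν ≤ v) (hl0 : 0 ≤ l) (hl1 : l ≤ 1) (N : ℕ) (s : ℝ) :
    (Measure.pi fun _ : Fin N => ν).real {S | s ≤ |deviation ν Z S|}
      ≤ 2 * Real.exp (N * (l ^ 2 * v) - l * s) := by
  have h1 : {S : Fin N → Ω | s ≤ |deviation ν Z S|} ⊆ {S | s ≤ deviation ν Z S} ∪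
      {S | s ≤ deviation ν (fun ω => - Z ω) S} := fun S hS => by
    rw [Set.mem_union, Set.mem_ofPred_eq, Set.mem_ofPred_eq, deviation_neg]
    exact le_abs.1 hS
  have h2 := measureReal_sum_ge_le ν hZ hv hl0 hl1 N s
  have h3 := measureReal_sum_ge_le ν (Z := fun ω => - Z ω) (by simpa using hZ)
    (by simpa using hv) hl0 hl1 N s
  calc _ ≤ _ := measureReal_mono h1
    _ ≤ _ := measureReal_union_le _ _
    _ ≤ _ := by rw [two_mul]; exact add_le_add h2 h3

lemma measureReal_exists_abs_deviation_ge_le (𝓗 : Finset (Ω → ℝ)) {v l : ℝ}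
    (hZ : ∀ Z ∈ 𝓗, (∀ ω, |Z ω| ≤ 1) ∧ ∫ ω, Z ω ^ 2 ∂ν ≤ v)
    (hl0 : 0 ≤ l) (hl1 : l ≤ 1) (N : ℕ) (s : ℝ) :
    (Measure.pi fun _ : Fin N => ν).real {S | ∃ Z ∈ 𝓗, s ≤ |deviation ν Z S|}
      ≤ 𝓗.card * (2 * Real.exp (N * (l ^ 2 * v) - l * s)) := by
  have h1 : {S : Fin N → Ω | ∃ Z ∈ 𝓗, s ≤ |deviation ν Z S|} =
      ⋃ Z ∈ 𝓗, {S | s ≤ |deviation ν Z S|} := by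
    ext; simp
  rw [h1]
  refine (measureReal_biUnion_finset_le _ _).trans ?_
  refine (Finset.sum_le_card_nsmul _ _ _ fun Z h => measureReal_abs_deviation_ge_le ν (hZ Z h).1
    (hZ Z h).2 hl0 hl1 N s).trans ?_
  simp

end Concentration

/-! ### Zeros of exponential sums, and cells between breakpoints. -/

/-- A real exponential sum with `n` terms vanishes identically or has at most `n` zeros. -/
lemma expSum_eq_zero_or_card_zeros_le {ι : Type*} (J : Finset ι) (a b : ι → ℝ) :
    (∀ x : ℝ, ∑ j ∈ J, a j * Real.exp (b j * x) = 0) ∨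
      ∀ Z : Finset ℝ, (∀ x ∈ Z, ∑ j ∈ J, a j * Real.exp (b j * x) = 0) → Z.card ≤ J.card := by
  classical
  induction J using Finset.induction_on generalizing a b with
  | empty => left; simp
  | insert i J hi ih =>
    -- Dividing by one exponential makes its term constant, so the derivative has one term fewer,
    -- and Rolle applies.
    set h : ℝ → ℝ := fun x => a i + ∑ j ∈ J, a j * Real.exp ((b j - b i) * x) with hh
    have h1 : ∀ x, ∑ j ∈ insert i J, a j * Real.exp (b j * x) = Real.exp (b i * x) * h x := by
      intro x
      rw [Finset.sum_insert hi, hh]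
      simp only [mul_add, Finset.mul_sum]
      congr 1
      · ring
      · refine Finset.sum_congr rfl fun j _ => ?_
        rw [mul_left_comm, ← Real.exp_add]
        ring_nf
    have h2 : ∀ x, HasDerivAt h
        (∑ j ∈ J, (a j * (b j - b i)) * Real.exp ((b j - b i) * x)) x := by
      intro x
      refine (HasDerivAt.const_add (a i) (HasDerivAt.fun_sum (u := J)
        (A' := fun j => (a j * (b j - b i)) * Real.exp ((b j - b i) * x)) fun j _ => ?_))
      have := (((hasDerivAt_id' x).const_mul (b j - b i)).exp).const_mul (a j)
      exact this.congr_deriv (by ring)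
    simp only [h1, mul_eq_zero, Real.exp_ne_zero, false_or]
    rcases ih (fun j => a j * (b j - b i)) (fun j => b j - b i) with h3 | h3
    -- If the derivative vanishes identically, `h` is constant: either it is zero, or it has no
    -- zeros at all.
    · have h4 : ∀ x, h x = h 0 := fun x =>
        is_const_of_deriv_eq_zero (fun y => (h2 y).differentiableAt)
          (fun y => by rw [(h2 y).deriv]; exact h3 y) x 0
      by_cases h0 : h 0 = 0
      · left; intro x; rw [h4, h0]
      · right
        intro Z hZ
        rcases Z.eq_empty_or_nonempty with rfl | ⟨x, hx⟩
        · simp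
        · exact absurd ((h4 x).symm.trans (hZ x hx)) h0
    · right
      intro Z hZ
      have h5 : {x : ℝ | ∑ j ∈ J, (a j * (b j - b i)) * Real.exp ((b j - b i) * x) = 0}.Finite := by
        by_contra hinf
        obtain ⟨W, hW, hc⟩ := Set.Infinite.exists_subset_card_eq hinf (J.card + 1)
        have := h3 W fun x hx => hW hx
        omega
      rw [Finset.card_insert_of_notMem hi]
      refine (Finset.card_le_of_interleaved (t := h5.toFinset) fun x hx y hy hxy _ => ?_).trans
        (Nat.add_le_add_right (h3 _ fun x hx => by simpa using hx) 1)
      obtain ⟨z, hz, hz'⟩ := exists_deriv_eq_zero hxy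
        (fun w _ => (h2 w).continuousAt.continuousWithinAt) ((hZ x hx).trans (hZ y hy).symm)
      refine ⟨z, ?_, hz⟩
      rw [(h2 z).deriv] at hz'
      simpa using hz'

/-- A function `x ↦ ∑ a_j u_j ^ x` with `n` terms and `u_j ≥ 0` vanishes identically on `x > 0`, or
has at most `n` positive zeros. -/
lemma powSum_eq_zero_or_card_zeros_le {ι : Type*} (J : Finset ι) (a u : ι → ℝ)
    (hu : ∀ j ∈ J, 0 ≤ u j) :
    (∀ x : ℝ, 0 < x → ∑ j ∈ J, a j * u j ^ x = 0) ∨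
      ∃ Z : Finset ℝ, Z.card ≤ J.card ∧
        ∀ x : ℝ, 0 < x → (∑ j ∈ J, a j * u j ^ x = 0 ↔ x ∈ Z) := by
  classical
  have h1 : ∀ x : ℝ, 0 < x → ∑ j ∈ J, a j * u j ^ x =
      ∑ j ∈ J with 0 < u j, a j * Real.exp (Real.log (u j) * x) := by
    intro x hx
    rw [Finset.sum_filter]
    refine Finset.sum_congr rfl fun j hj => ?_
    split_ifs with h
    · rw [Real.rpow_def_of_pos h]
    · rw [le_antisymm (not_lt.1 h) (hu j hj), Real.zero_rpow hx.ne', mul_zero]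
  rcases expSum_eq_zero_or_card_zeros_le {j ∈ J | 0 < u j} a (fun j => Real.log (u j)) with h | h
  · left
    intro x hx
    rw [h1 x hx, h]
  · right
    have h5 : {x : ℝ | ∑ j ∈ J with 0 < u j, a j * Real.exp (Real.log (u j) * x) = 0}.Finite := by
      by_contra hinf
      obtain ⟨W, hW, hc⟩ := Set.Infinite.exists_subset_card_eq hinf
        ((Finset.card {j ∈ J | 0 < u j}) + 1)
      have := h W fun x hx => hW hx
      omega
    refine ⟨h5.toFinset, (h _ fun x hx => by simpa using hx).trans (Finset.card_filter_le _ _),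
      fun x hx => ?_⟩
    rw [h1 x hx]
    simp

/-- No element of `A` separates `x` from `y`: both lie in the same cell of the partition of the line
into the points of `A` and the open intervals between them. -/
def SameCell (A : Finset ℝ) (x y : ℝ) : Prop :=
  ∀ a ∈ A, (a < x ↔ a < y) ∧ (a = x ↔ a = y)

lemma SameCell.symm {A : Finset ℝ} {x y : ℝ} (h : SameCell A x y) : SameCell A y x :=
  fun a ha => ⟨(h a ha).1.symm, (h a ha).2.symm⟩

lemma SameCell.mono {A A' : Finset ℝ} {x y : ℝ} (h : SameCell A x y) (hA : A' ⊆ A) :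
    SameCell A' x y := fun a ha => h a (hA ha)

lemma SameCell.lt_iff {A : Finset ℝ} {x y a : ℝ} (h : SameCell A x y) (ha : a ∈ A) :
    x < a ↔ y < a := by
  have := h a ha
  rcases lt_trichotomy a x with h1 | h1 | h1 <;> rcases lt_trichotomy a y with h2 | h2 | h2 <;>
    grind

/-- A continuous function whose zeros are in `A` has a constant sign on each cell. -/
lemma SameCell.nonpos_of_nonpos {A : Finset ℝ} {h : ℝ → ℝ} (hc : ContinuousOn h (Set.Ioi 0))
    (hA : ∀ x, 0 < x → h x = 0 → x ∈ A) {x y : ℝ} (hx : 0 < x) (hy : 0 < y)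
    (hxy : SameCell A x y) (hle : h x ≤ 0) : h y ≤ 0 := by
  by_contra! hpos
  have hne : x ≠ y := by rintro rfl; linarith
  have hsub : Set.uIcc x y ⊆ Set.Ioi 0 := fun z hz =>
    lt_of_lt_of_le (lt_min hx hy) hz.1
  obtain ⟨z, hz, hz0⟩ := intermediate_value_uIcc (hc.mono hsub)
    (show (0 : ℝ) ∈ Set.uIcc (h x) (h y) from Set.mem_uIcc.2 (Or.inl ⟨hle, hpos.le⟩))
  have hzA := hA z (hsub hz) hz0
  have h1 := hxy z hzA
  have h2 := hxy.lt_iff hzA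
  rcases Set.mem_uIcc.1 hz with h3 | h3 <;> grind

/-! ### Chaining along nets. -/

/-- Union bound at the `k`-th scale, with `x = N ε ^ 2`: the exponent grows like `2 ^ k`, while the
logarithm of the number of functions grows only linearly in `k`. The failure probabilities therefore
sum to at most `δ`. -/
lemma chaining_level_bound {M δ x : ℝ} (hM : 2 ≤ M) (hδ : 0 < δ) (hδ1 : δ ≤ 1)
    (hx : 101376 * (Real.log M + Real.log (1 / δ)) ≤ x) (k : ℕ) :
    2 * (M * 8 ^ k) ^ 10 * (2 * Real.exp (-(x * 2 ^ k / 2304))) ≤ δ * (1 / 2) ^ (k + 1) := by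
  have hM0 : 0 < M := by linarith
  set Lm := Real.log M with hLm
  set Ld := Real.log (1 / δ) with hLd
  have hLm0 : 0 ≤ Lm := Real.log_nonneg (by linarith)
  have hLd0 : 0 ≤ Ld := Real.log_nonneg (by rw [le_div_iff₀ hδ]; linarith)
  have heM : Real.exp Lm = M := Real.exp_log hM0
  have heD : Real.exp (-Ld) = δ := by
    rw [hLd, one_div, Real.log_inv, neg_neg, Real.exp_log hδ]
  have h1 : 2 * (M * 8 ^ k) ^ 10 * 2 ≤ Real.exp ((12 + 30 * k) * Lm) := by
    have h2 : Real.exp ((12 + 30 * k) * Lm) = M ^ (12 + 30 * k) := by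
      rw [← heM, ← Real.exp_nat_mul]; push_cast; simp [hLm]
    have h8 : (8 : ℝ) ^ k ≤ (M ^ 3) ^ k := by
      gcongr
      calc (8 : ℝ) = 2 ^ 3 := by norm_num
        _ ≤ M ^ 3 := by gcongr
    rw [h2]
    calc 2 * (M * 8 ^ k) ^ 10 * 2 ≤ M * (M * (M ^ 3) ^ k) ^ 10 * M := by gcongr
      _ = M ^ (12 + 30 * k) := by rw [pow_add, mul_pow, ← pow_mul, ← pow_mul]; ring_nf
  have hk : ((k : ℝ) + 1) ≤ 2 ^ k := by
    have : k + 1 ≤ 2 ^ k := Nat.lt_two_pow_self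
    exact_mod_cast this
  have hk0 : (0 : ℝ) ≤ k := k.cast_nonneg
  calc 2 * (M * 8 ^ k) ^ 10 * (2 * Real.exp (-(x * 2 ^ k / 2304)))
      = (2 * (M * 8 ^ k) ^ 10 * 2) * Real.exp (-(x * 2 ^ k / 2304)) := by ring
    _ ≤ Real.exp ((12 + 30 * k) * Lm) * Real.exp (-(x * 2 ^ k / 2304)) := by gcongr
    _ = Real.exp ((12 + 30 * k) * Lm - x * 2 ^ k / 2304) := by rw [← Real.exp_add]; ring_nf
    _ ≤ Real.exp (-Ld - (k + 1) * Lm) := by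
        apply Real.exp_le_exp.2
        -- Here `101376 = 44 * 2304`, and `44 (k + 1)` exceeds `(12 + 30 k) + (k + 1)`.
        have h3 : 101376 * (Lm + Ld) * ((k : ℝ) + 1) ≤ x * 2 ^ k := by
          apply mul_le_mul hx hk (by positivity)
          linarith
        nlinarith [mul_nonneg hk0 hLm0, mul_nonneg hk0 hLd0]
    _ = δ * (1 / M) ^ (k + 1) := by
        have : Real.exp (-Lm) = 1 / M := by rw [Real.exp_neg, heM, one_div]
        rw [sub_eq_add_neg, Real.exp_add, heD, ← this, ← Real.exp_nat_mul]
        push_cast; ring_nf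
    _ ≤ _ := by gcongr

section Chaining

variable {Ω Θ : Type*} [MeasurableSpace Ω] (ν : Measure Ω)

/-- The family `g` can be approximated at each scale `γ`: up to events of probability at most `γ`
that only depend on the approximating function, it consists of at most `(M / γ) ^ 5` functions. -/
def HasNets (g : Θ → Ω → ℝ) (M : ℝ) : Prop :=
  ∀ γ : ℝ, 0 < γ → γ ≤ 1 → ∃ (m : ℕ) (π : Θ → Fin m) (r : Fin m → Θ) (E : Fin m → Set Ω),
    (m : ℝ) ≤ (M / γ) ^ 5 ∧ (∀ i, ν.real (E i) ≤ γ) ∧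
      ∀ θ ω, ω ∉ E (π θ) → g θ ω = g (r (π θ)) ω

variable [Finite Ω] [MeasurableSingletonClass Ω] [IsProbabilityMeasure ν]

/-- Controls the last remainder of the chain. The remainders may be infinitely many functions, but
they are dominated by finitely many indicators `b`, and a union bound over those suffices. -/
lemma abs_deviation_le {N : ℕ} {h b : Ω → ℝ} (hb : ∀ ω, |h ω| ≤ b ω)
    (S : Fin N → Ω) :
    |deviation ν h S| ≤ |deviation ν b S| + 2 * N * ∫ ω, b ω ∂ν := by
  have h1 : |∑ j, h (S j)| ≤ ∑ j, b (S j) :=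
    (Finset.abs_sum_le_sum_abs _ _).trans (Finset.sum_le_sum fun j _ => hb _)
  have h2 : |∫ ω, h ω ∂ν| ≤ ∫ ω, b ω ∂ν :=
    (abs_integral_le_integral_abs).trans (integral_mono (.of_finite) (.of_finite) hb)
  have h3 : |(N : ℝ) * ∫ ω, h ω ∂ν| ≤ N * ∫ ω, b ω ∂ν := by
    rw [abs_mul, Nat.abs_cast]; gcongr
  have h4 := le_abs_self (deviation ν b S)
  have h5 := abs_sub (∑ j, h (S j)) (N * ∫ ω, h ω ∂ν)
  simp only [deviation] at *
  linarith

lemma integral_sq_sub_le {g₁ g₂ : Ω → ℝ} (hg : ∀ ω, |g₁ ω - g₂ ω| ≤ 1) {E E' : Set Ω}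
    (h : ∀ ω, ω ∉ E → ω ∉ E' → g₁ ω = g₂ ω) :
    ∫ ω, (g₁ ω - g₂ ω) ^ 2 ∂ν ≤ ν.real E + ν.real E' := by
  have h1 : ∀ A : Set Ω, ∫ ω, A.indicator (fun _ => (1 : ℝ)) ω ∂ν = ν.real A := fun A => by
    rw [integral_indicator A.toFinite.measurableSet]; simp
  rw [← h1, ← h1, ← integral_add (.of_finite) (.of_finite)]
  refine integral_mono (.of_finite) (.of_finite) fun ω => ?_
  have h2 : (g₁ ω - g₂ ω) ^ 2 ≤ 1 := by
    rw [← sq_abs]; exact pow_le_one₀ (abs_nonneg _) (hg ω)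
  by_cases hE : ω ∈ E <;> by_cases hE' : ω ∈ E' <;>
    simp only [hE, hE', Set.indicator_of_mem, Set.indicator_of_notMem, not_false_eq_true]
  · linarith
  · linarith
  · linarith
  · simp [h ω hE hE']

/-- Chaining along nets: at the `k`-th scale there are few functions, of variance `O(8 ^ (-k))`,
whose deviations control those of the whole family. -/
lemma HasNets.exists_chain {g : Θ → Ω → ℝ} {M : ℝ} (hM : 2 ≤ M) (hg : HasNets ν g M)
    (hg0 : ∀ θ ω, 0 ≤ g θ ω) (hg1 : ∀ θ ω, g θ ω ≤ 1) :
    ∃ 𝓗 : ℕ → Finset (Ω → ℝ), (∀ k, ((𝓗 k).card : ℝ) ≤ 2 * (M * 8 ^ k) ^ 10) ∧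
      (∀ k, ∀ Z ∈ 𝓗 k, (∀ ω, |Z ω| ≤ 1) ∧ ∫ ω, Z ω ^ 2 ∂ν ≤ 9 / 8 ^ k) ∧
      ∀ (N : ℕ) (S : Fin N → Ω) (d : ℝ) (L : ℕ),
        (∀ k ≤ L, ∀ Z ∈ 𝓗 k, |deviation ν Z S| ≤ d / 2 ^ k) →
          ∀ θ, |deviation ν (g θ) S| ≤ 3 * d + 2 * N / 8 ^ L := by
  classical
  choose m π r E hm hE hπ using fun k : ℕ => hg ((1 / 8) ^ k) (by positivity)
    (pow_le_one₀ (by norm_num) (by norm_num))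
  have hm' : ∀ k, (m k : ℝ) ≤ (M * 8 ^ k) ^ 5 := fun k => by
    refine (hm k).trans_eq ?_
    rw [one_div, inv_pow, div_inv_eq_mul]
  have hE' : ∀ k i, ν.real (E k i) ≤ 1 / 8 ^ k := fun k i => by
    refine (hE k i).trans_eq ?_
    rw [div_pow, one_pow]
  have habs : ∀ θ θ' ω, |g θ ω - g θ' ω| ≤ 1 := fun θ θ' ω => by
    rw [abs_le]; constructor <;> linarith [hg0 θ ω, hg1 θ ω, hg0 θ' ω, hg1 θ' ω]
  have hone : ∀ k : ℕ, (1 : ℝ) ≤ (M * 8 ^ k) ^ 5 := fun k =>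
    one_le_pow₀ (one_le_mul_of_one_le_of_one_le (by linarith) (one_le_pow₀ (by norm_num)))
  have hone' : ∀ k : ℕ, (M * 8 ^ k) ^ 5 ≤ (M * 8 ^ k) ^ 10 := fun k =>
    pow_le_pow_right₀ (one_le_mul_of_one_le_of_one_le (by linarith)
      (one_le_pow₀ (by norm_num))) (by norm_num)
  let ind : ∀ k, Finset (Ω → ℝ) := fun k =>
    Finset.univ.image fun i : Fin (m k) => (E k i).indicator fun _ => (1 : ℝ)
  -- Only pairs of cells that share a parameter are linked: both representatives then agree with
  -- that parameter off two small events, so the link has small variance.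
  let lnk : ℕ → Finset (Ω → ℝ) := fun k => match k with
    | 0 => Finset.univ.image fun i : Fin (m 0) => g (r 0 i)
    | k + 1 => ((Finset.univ : Finset (Fin (m (k + 1)) × Fin (m k))).filter fun p =>
        ∃ θ, π (k + 1) θ = p.1 ∧ π k θ = p.2).image fun p ω => g (r (k + 1) p.1) ω - g (r k p.2) ω
  have hindc : ∀ k, ((ind k).card : ℝ) ≤ (M * 8 ^ k) ^ 5 := fun k => by
    refine le_trans ?_ (hm' k)
    exact_mod_cast Finset.card_image_le.trans (by simp)
  have hlnkc : ∀ k, ((lnk k).card : ℝ) ≤ (M * 8 ^ k) ^ 10 := fun k => by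
    match k with
    | 0 =>
      refine le_trans (le_trans ?_ (hm' 0)) (hone' 0)
      exact_mod_cast Finset.card_image_le.trans (by simp)
    | k + 1 =>
      have h1 : ((lnk (k + 1)).card : ℝ) ≤ m (k + 1) * m k := by
        exact_mod_cast (Finset.card_image_le.trans (Finset.card_filter_le _ _)).trans (by simp)
      calc _ ≤ _ := h1
        _ ≤ (M * 8 ^ (k + 1)) ^ 5 * (M * 8 ^ k) ^ 5 := by
            gcongr
            · exact hm' _
            · exact hm' _
        _ ≤ (M * 8 ^ (k + 1)) ^ 5 * (M * 8 ^ (k + 1)) ^ 5 := by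
            gcongr
            · norm_num
            · simp
        _ = _ := by rw [← pow_add]
  refine ⟨fun k => lnk k ∪ ind k, fun k => ?_, fun k Z hZ => ?_, fun N S d L hd θ => ?_⟩
  · have : (((lnk k ∪ ind k).card : ℕ) : ℝ) ≤ (lnk k).card + (ind k).card := by
      exact_mod_cast Finset.card_union_le _ _
    linarith [hindc k, hlnkc k, hone' k]
  · rcases Finset.mem_union.1 hZ with hZ | hZ
    · match k, hZ with
      | 0, hZ =>
        obtain ⟨i, -, rfl⟩ := Finset.mem_image.1 hZ
        refine ⟨fun ω => by rw [abs_of_nonneg (hg0 _ _)]; exact hg1 _ _, ?_⟩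
        calc ∫ ω, g (r 0 i) ω ^ 2 ∂ν ≤ ∫ ω, (1 : ℝ) ∂ν :=
              integral_mono (.of_finite) (.of_finite) fun ω => pow_le_one₀ (hg0 _ _) (hg1 _ _)
          _ ≤ _ := by norm_num
      | k + 1, hZ =>
        obtain ⟨⟨i, i'⟩, hp, rfl⟩ := Finset.mem_image.1 hZ
        obtain ⟨θ, rfl, rfl⟩ := (Finset.mem_filter.1 hp).2
        refine ⟨fun ω => habs _ _ _, (integral_sq_sub_le ν (habs _ _)
          (E := E (k + 1) (π (k + 1) θ)) (E' := E k (π k θ)) fun ω h h' => ?_).trans ?_⟩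
        · rw [← hπ _ _ _ h, ← hπ _ _ _ h']
        · refine (add_le_add (hE' _ _) (hE' _ _)).trans_eq ?_
          -- `1 / 8 ^ (k + 1) + 1 / 8 ^ k = 9 / 8 ^ (k + 1)`, the source of the constant 9.
          rw [pow_succ]; field_simp; norm_num
    · obtain ⟨i, -, rfl⟩ := Finset.mem_image.1 hZ
      constructor
      · intro ω
        by_cases h : ω ∈ E k i <;> simp [h]
      · have h1 : ∀ ω, (E k i).indicator (fun _ => (1 : ℝ)) ω ^ 2 =
            (E k i).indicator (fun _ => (1 : ℝ)) ω := fun ω => by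
          by_cases h : ω ∈ E k i <;> simp [h]
        simp only [h1]
        rw [integral_indicator (Set.toFinite _).measurableSet]
        simp only [integral_const, smul_eq_mul, mul_one, measureReal_restrict_apply_univ]
        refine (hE' k i).trans ?_
        gcongr
        norm_num
  · have hd0 : 0 ≤ d := by
      have h1 := hd 0 (Nat.zero_le _) (g (r 0 (π 0 θ)))
        (Finset.mem_union_left _ (Finset.mem_image_of_mem _ (Finset.mem_univ _)))
      have := (abs_nonneg _).trans h1
      simpa using this
    -- Partial sums of the geometric series `d + d / 2 + d / 4 + ⋯`.
    have hchain : ∀ k ≤ L, |deviation ν (g (r k (π k θ))) S| ≤ d * (2 - 1 / 2 ^ k) := by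
      intro k
      induction k with
      | zero =>
        intro _
        have h1 := hd 0 (Nat.zero_le _) (g (r 0 (π 0 θ)))
          (Finset.mem_union_left _ (Finset.mem_image_of_mem _ (Finset.mem_univ _)))
        norm_num at h1 ⊢
        exact h1
      | succ k ih =>
        intro hk
        have h1 := ih (by omega)
        have h2 := hd (k + 1) hk (fun ω => g (r (k + 1) (π (k + 1) θ)) ω - g (r k (π k θ)) ω)
          (Finset.mem_union_left _ (Finset.mem_image.2 ⟨(π (k + 1) θ, π k θ),
            Finset.mem_filter.2 ⟨Finset.mem_univ _, θ, rfl, rfl⟩, rfl⟩))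
        have h3 := deviation_add ν (g (r k (π k θ)))
          (fun ω => g (r (k + 1) (π (k + 1) θ)) ω - g (r k (π k θ)) ω) S
        simp only [add_sub_cancel] at h3
        rw [show (fun ω => g (r (k + 1) (π (k + 1) θ)) ω) = g (r (k + 1) (π (k + 1) θ)) from rfl]
          at h3
        rw [h3]
        refine (abs_add_le _ _).trans ((add_le_add h1 h2).trans_eq ?_)
        rw [pow_succ]; field_simp; ring
    have h1 := hchain L le_rfl
    have h2 := deviation_add ν (g (r L (π L θ))) (fun ω => g θ ω - g (r L (π L θ)) ω) S
    simp only [add_sub_cancel] at h2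
    rw [show (fun ω => g θ ω) = g θ from rfl] at h2
    have h3 := abs_deviation_le ν (h := fun ω => g θ ω - g (r L (π L θ)) ω)
      (b := (E L (π L θ)).indicator fun _ => (1 : ℝ)) (fun ω => by
        by_cases h : ω ∈ E L (π L θ)
        · simpa [h] using habs _ _ _
        · simp [h, hπ L θ ω h]) S
    have h4 := hd L le_rfl ((E L (π L θ)).indicator fun _ => (1 : ℝ))
      (Finset.mem_union_right _ (Finset.mem_image_of_mem _ (Finset.mem_univ _)))
    rw [integral_indicator (Set.toFinite _).measurableSet] at h3
    simp only [integral_const, smul_eq_mul, mul_one, measureReal_restrict_apply_univ] at h3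
    have h5 : 2 * (N : ℝ) * ν.real (E L (π L θ)) ≤ 2 * N * (1 / 8 ^ L) := by
      gcongr
      exact hE' _ _
    have h6 : d / 2 ^ L ≤ d := div_le_self hd0 (one_le_pow₀ (by norm_num))
    have h7 : d * (2 - 1 / 2 ^ L) ≤ 2 * d := by
      have : 0 ≤ d * (1 / 2 ^ L) := by positivity
      linarith
    have h8 : 2 * (N : ℝ) * (1 / 8 ^ L) = 2 * N / 8 ^ L := by ring
    rw [h2]
    linarith [abs_add_le (deviation ν (g (r L (π L θ))) S)
      (deviation ν (fun ω => g θ ω - g (r L (π L θ)) ω) S)]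

/-- Uniform convergence without logarithmic losses for families with nets of polynomial size. -/
theorem HasNets.uniform_deviation {g : Θ → Ω → ℝ} {M : ℝ} (hM : 2 ≤ M) (hg : HasNets ν g M)
    (hg0 : ∀ θ ω, 0 ≤ g θ ω) (hg1 : ∀ θ ω, g θ ω ≤ 1) {ε δ : ℝ} (hε : 0 < ε) (hε1 : ε ≤ 1)
    (hδ : 0 < δ) (hδ1 : δ ≤ 1) {N : ℕ}
    (hN : 101376 * (Real.log M + Real.log (1 / δ)) ≤ N * ε ^ 2) :
    (Measure.pi fun _ : Fin N => ν).real {S | ¬ ∀ θ, |deviation ν (g θ) S| ≤ N * ε / 2} ≤ δ := by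
  obtain ⟨𝓗, hcard, hvar, hchain⟩ := hg.exists_chain ν hM hg0 hg1
  have hex : ∃ L : ℕ, (1 / 8 : ℝ) ^ L ≤ ε / 16 := by
    obtain ⟨L, hL⟩ := exists_pow_lt_of_lt_one (show 0 < ε / 16 by positivity)
      (show (1 / 8 : ℝ) < 1 by norm_num)
    exact ⟨L, hL.le⟩
  classical
  -- The first scale at which the remainder is negligible. Minimality bounds `ε * 8 ^ k` by 128 for
  -- all `k ≤ L`, which keeps the Chernoff parameter at most 1.
  obtain ⟨L, hL, hLmin⟩ : ∃ L : ℕ, (1 / 8 : ℝ) ^ L ≤ ε / 16 ∧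
      ∀ k < L, ε / 16 < (1 / 8 : ℝ) ^ k :=
    ⟨Nat.find hex, Nat.find_spec hex, fun k hk => not_le.1 (Nat.find_min hex hk)⟩
  have hl1 : ∀ k ≤ L, ε * 4 ^ k / 144 ≤ 1 := by
    intro k hk
    have h48 : (4 : ℝ) ^ k ≤ 8 ^ k := by gcongr; norm_num
    suffices ε * 8 ^ k ≤ 128 by nlinarith
    cases k with
    | zero => simp; linarith
    | succ k =>
      have := hLmin k (by omega)
      rw [div_pow, one_pow, lt_div_iff₀ (by positivity)] at this
      rw [pow_succ]; linarith
  let bad : ℕ → Set (Fin N → Ω) := fun k =>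
    {S | ∃ Z ∈ 𝓗 k, N * ε / 8 / 2 ^ k ≤ |deviation ν Z S|}
  have hbad : ∀ k ≤ L, (Measure.pi fun _ : Fin N => ν).real (bad k) ≤ δ * (1 / 2) ^ (k + 1) := by
    intro k hk
    -- This `l` is `s / (2 N v)`, the minimizer of `N l ^ 2 v - l s` for `s = N ε / (8 * 2 ^ k)` and
    -- `v = 9 / 8 ^ k`.
    refine (measureReal_exists_abs_deviation_ge_le ν (𝓗 k) (hvar k) (l := ε * 4 ^ k / 144)
      (by positivity) (hl1 k hk) N _).trans ?_
    refine le_trans ?_ (chaining_level_bound hM hδ hδ1 hN k)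
    have h1 : (N : ℝ) * ((ε * 4 ^ k / 144) ^ 2 * (9 / 8 ^ k)) -
        ε * 4 ^ k / 144 * (N * ε / 8 / 2 ^ k) = -(N * ε ^ 2 * 2 ^ k / 2304) := by
      have h4 : (4 : ℝ) ^ k = 2 ^ k * 2 ^ k := by rw [← mul_pow]; norm_num
      have h8 : (8 : ℝ) ^ k = 2 ^ k * 2 ^ k * 2 ^ k := by rw [← mul_pow, ← mul_pow]; norm_num
      rw [h4, h8]
      field_simp
      ring
    rw [h1]
    gcongr
    exact hcard k
  have hsub : {S : Fin N → Ω | ¬ ∀ θ, |deviation ν (g θ) S| ≤ N * ε / 2} ⊆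
      ⋃ k ∈ Finset.range (L + 1), bad k := by
    intro S hS
    by_contra hcon
    -- With `d = N ε / 8`, the chain costs `3 N ε / 8` and the remainder term at most `N ε / 8`.
    refine hS fun θ => (hchain N S (N * ε / 8) L (fun k hk Z hZ => ?_) θ).trans ?_
    · by_contra! hlt
      exact hcon (Set.mem_biUnion (Finset.mem_coe.2 (Finset.mem_range.2 (by omega)))
        ⟨Z, hZ, hlt.le⟩)
    · rw [div_pow, one_pow] at hL
      have : 2 * (N : ℝ) / 8 ^ L ≤ 2 * N * (ε / 16) := by
        rw [div_eq_mul_one_div]; gcongr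
      linarith
  calc _ ≤ _ := measureReal_mono hsub (measure_ne_top _ _)
    _ ≤ ∑ k ∈ Finset.range (L + 1), (Measure.pi fun _ : Fin N => ν).real (bad k) :=
        measureReal_biUnion_finset_le _ _
    _ ≤ ∑ k ∈ Finset.range (L + 1), δ * (1 / 2) ^ (k + 1) :=
        Finset.sum_le_sum fun k hk => hbad k (by have := Finset.mem_range.1 hk; omega)
    _ = δ / 2 * ∑ k ∈ Finset.range (L + 1), (1 / 2 : ℝ) ^ k := by
        rw [Finset.mul_sum]
        exact Finset.sum_congr rfl fun k _ => by rw [pow_succ]; ring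
    _ ≤ δ / 2 * 2 := by
        gcongr
        rw [geom_sum_eq (by norm_num)]
        have : (0 : ℝ) < (1 / 2) ^ (L + 1) := by positivity
        rw [div_le_iff_of_neg (by norm_num)]
        linarith
    _ = δ := by ring

end Chaining

/-! ### Nets from random breakpoints. -/

section Nets

variable {Ω : Type*} [Finite Ω] [MeasurableSpace Ω] [MeasurableSingletonClass Ω]
  (ν : Measure Ω) [IsProbabilityMeasure ν]

/-- Given a random set of at most `M` breakpoints, the line is partitioned into `O((M / γ) ^ 2)`
cells, each of which is separated by some breakpoint with probability at most `2 γ`. -/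
lemma exists_cells (A : Ω → Finset ℝ) {M γ : ℝ} (hA : ∀ ω, ((A ω).card : ℝ) ≤ M) (hγ : 0 < γ) :
    ∃ (m : ℕ) (q : ℝ → Fin m) (E : Fin m → Set Ω), (m : ℝ) ≤ (M / γ + 1) ^ 2 ∧
      (∀ i, ν.real (E i) ≤ 2 * γ) ∧
      ∀ x y ω, q x = q y → ω ∉ E (q x) → SameCell (A ω) x y := by
  have hΩ : Nonempty Ω := nonempty_of_isProbabilityMeasure ν
  have hM : 0 ≤ M := (Nat.cast_nonneg _).trans (hA hΩ.some)
  -- For `x < y`, the increments of `F` and `G` are the expected numbers of breakpoints in `(x, y]`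
  -- and in `[x, y)`. Both are needed to detect breakpoints at either end of `[x, y]`, since atoms
  -- are possible.
  let F : ℝ → ℝ := fun x => ∫ ω, (((A ω).filter fun a => a ≤ x).card : ℝ) ∂ν
  let G : ℝ → ℝ := fun x => ∫ ω, (((A ω).filter fun a => a < x).card : ℝ) ∂ν
  have hbound : ∀ c : Ω → ℕ, (∀ ω, c ω ≤ (A ω).card) → ∫ ω, (c ω : ℝ) ∂ν ≤ M := fun c hc => by
    calc ∫ ω, (c ω : ℝ) ∂ν ≤ ∫ _, M ∂ν := integral_mono (.of_finite) (.of_finite) fun ω =>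
          (Nat.cast_le.2 (hc ω)).trans (hA ω)
      _ = M := by simp
  have hF0 : ∀ x, 0 ≤ F x := fun x => integral_nonneg fun ω => Nat.cast_nonneg _
  have hG0 : ∀ x, 0 ≤ G x := fun x => integral_nonneg fun ω => Nat.cast_nonneg _
  have hF1 : ∀ x, F x ≤ M := fun x => hbound _ fun ω => Finset.card_filter_le _ _
  have hG1 : ∀ x, G x ≤ M := fun x => hbound _ fun ω => Finset.card_filter_le _ _
  set m := ⌊M / γ⌋₊ + 1 with hm
  let q : ℝ → Fin m × Fin m := fun x =>
    (⟨⌊F x / γ⌋₊, Nat.lt_succ_of_le (Nat.floor_le_floor (by gcongr; exact hF1 x))⟩,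
      ⟨⌊G x / γ⌋₊, Nat.lt_succ_of_le (Nat.floor_le_floor (by gcongr; exact hG1 x))⟩)
  have hfl : ∀ u v : ℝ, 0 ≤ u → 0 ≤ v → ⌊u / γ⌋₊ = ⌊v / γ⌋₊ → v - u ≤ γ := by
    intro u v hu hv h
    have h1 := Nat.floor_le (div_nonneg hu hγ.le)
    have h2 := Nat.lt_floor_add_one (v / γ)
    rw [← h] at h2
    have h3 : v / γ - u / γ ≤ 1 := by linarith
    rwa [← sub_div, div_le_one hγ] at h3
  have hq : ∀ x y, q x = q y → F y - F x ≤ γ ∧ G y - G x ≤ γ := by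
    intro x y h
    simp only [q, Prod.mk.injEq, Fin.mk.injEq] at h
    exact ⟨hfl _ _ (hF0 x) (hF0 y) h.1, hfl _ _ (hG0 x) (hG0 y) h.2⟩
  let E : Fin m × Fin m → Set Ω := fun i =>
    {ω | ∃ x y, q x = i ∧ q y = i ∧ ¬ SameCell (A ω) x y}
  have hE : ∀ i, ν.real (E i) ≤ 2 * γ := by
    intro i
    rcases (E i).eq_empty_or_nonempty with h0 | h0
    · rw [h0]; simp; positivity
    have h1 : ∀ ω ∈ E i, ∃ x y, q x = i ∧ q y = i ∧ x < y ∧ ∃ a ∈ A ω, x ≤ a ∧ a ≤ y := by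
      rintro ω ⟨x, y, hx, hy, hxy⟩
      have key : ∀ x y : ℝ, x ≤ y → ¬ SameCell (A ω) x y →
          x < y ∧ ∃ a ∈ A ω, x ≤ a ∧ a ≤ y := by
        intro x y hle h
        simp only [SameCell, not_forall] at h
        obtain ⟨a, ha, h⟩ := h
        have hlt : x < y := lt_of_le_of_ne hle (by rintro rfl; exact h ⟨Iff.rfl, Iff.rfl⟩)
        refine ⟨hlt, a, ha, ?_, ?_⟩
        · by_contra! hc
          exact h ⟨by grind, by grind⟩
        · by_contra! hc
          exact h ⟨by grind, by grind⟩
      rcases le_total x y with hle | hle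
      · exact ⟨x, y, hx, hy, key x y hle hxy⟩
      · exact ⟨y, x, hy, hx, key y x hle fun hs => hxy hs.symm⟩
    choose! x y hx hy hlt a ha hxa hay using h1
    -- Finiteness of `Ω` gives one interval, with both ends in the cell, containing a breakpoint for
    -- every `ω` in `E i`. Markov's inequality for that interval then bounds the probability.
    obtain ⟨ω₀, hω₀, hmin⟩ := Set.exists_min_image (E i) x (Set.toFinite _) h0
    obtain ⟨ω₁, hω₁, hmax⟩ := Set.exists_max_image (E i) y (Set.toFinite _) h0
    have hlt' : x ω₀ < y ω₁ := (hlt ω₀ hω₀).trans_le (hmax ω₀ hω₀)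
    have h2 : ∀ ω, (E i).indicator (fun _ => (1 : ℝ)) ω ≤
        ((((A ω).filter fun a => a ≤ y ω₁).card : ℝ) - ((A ω).filter fun a => a ≤ x ω₀).card) +
        ((((A ω).filter fun a => a < y ω₁).card : ℝ) - ((A ω).filter fun a => a < x ω₀).card) := by
      intro ω
      have hs1 : (A ω).filter (fun a => a ≤ x ω₀) ⊆ (A ω).filter fun a => a ≤ y ω₁ :=
        Finset.monotone_filter_right _ fun a _ h => h.trans hlt'.le
      have hs2 : (A ω).filter (fun a => a < x ω₀) ⊆ (A ω).filter fun a => a < y ω₁ :=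
        Finset.monotone_filter_right _ fun a _ h => h.trans hlt'
      have hc1 : (((A ω).filter fun a => a ≤ x ω₀).card : ℝ) ≤
          ((A ω).filter fun a => a ≤ y ω₁).card := by exact_mod_cast Finset.card_le_card hs1
      have hc2 : (((A ω).filter fun a => a < x ω₀).card : ℝ) ≤
          ((A ω).filter fun a => a < y ω₁).card := by exact_mod_cast Finset.card_le_card hs2
      by_cases hω : ω ∈ E i
      · rw [Set.indicator_of_mem hω]
        have h3 : x ω₀ ≤ a ω := (hmin ω hω).trans (hxa ω hω)
        have h4 : a ω ≤ y ω₁ := (hay ω hω).trans (hmax ω hω)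
        rcases h3.lt_or_eq with h5 | h5
        · have : ((A ω).filter fun a => a ≤ x ω₀).card + 1 ≤
              ((A ω).filter fun a => a ≤ y ω₁).card :=
            Finset.card_lt_card ((Finset.ssubset_iff_of_subset hs1).2 ⟨a ω,
              Finset.mem_filter.2 ⟨ha ω hω, h4⟩, fun hc => by
                have := (Finset.mem_filter.1 hc).2; linarith⟩)
          have : (((A ω).filter fun a => a ≤ x ω₀).card : ℝ) + 1 ≤
              ((A ω).filter fun a => a ≤ y ω₁).card := by exact_mod_cast this
          linarith
        · have : ((A ω).filter fun a => a < x ω₀).card + 1 ≤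
              ((A ω).filter fun a => a < y ω₁).card :=
            Finset.card_lt_card ((Finset.ssubset_iff_of_subset hs2).2 ⟨a ω,
              Finset.mem_filter.2 ⟨ha ω hω, h5 ▸ hlt'⟩, fun hc => by
                have := (Finset.mem_filter.1 hc).2; linarith⟩)
          have : (((A ω).filter fun a => a < x ω₀).card : ℝ) + 1 ≤
              ((A ω).filter fun a => a < y ω₁).card := by exact_mod_cast this
          linarith
      · rw [Set.indicator_of_notMem hω]
        linarith
    have h3 := hq (x ω₀) (y ω₁) ((hx ω₀ hω₀).trans (hy ω₁ hω₁).symm)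
    calc ν.real (E i) = ∫ ω, (E i).indicator (fun _ => (1 : ℝ)) ω ∂ν := by
          rw [integral_indicator (Set.toFinite _).measurableSet]; simp
      _ ≤ _ := integral_mono (.of_finite) (.of_finite) h2
      _ = (F (y ω₁) - F (x ω₀)) + (G (y ω₁) - G (x ω₀)) := by
          rw [integral_add (.of_finite) (.of_finite), integral_sub (.of_finite) (.of_finite),
            integral_sub (.of_finite) (.of_finite)]
      _ ≤ 2 * γ := by linarith
  let e : Fin m × Fin m ≃ Fin (m * m) := finProdFinEquiv
  refine ⟨m * m, fun x => e (q x), fun i => E (e.symm i), ?_, fun i => hE _, ?_⟩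
  · have : (m : ℝ) ≤ M / γ + 1 := by
      rw [hm]; push_cast; gcongr; exact Nat.floor_le (by positivity)
    push_cast
    rw [sq]
    gcongr
  · intro x y ω hxy hω
    have hxy' : q x = q y := e.injective hxy
    by_contra hc
    exact hω (by dsimp only; rw [e.symm_apply_apply]; exact ⟨x, y, rfl, hxy'.symm, hc⟩)

/-- A family which is parametrized by two reals and one of `B` values, and is piecewise constant in
the reals with few breakpoints, has small nets. -/
lemma hasNets_of_breakpoints {Θ : Type*} [Nonempty Θ] {B : ℕ} (x y : Θ → ℝ) (b : Θ → Fin B)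
    (g : Θ → Ω → ℝ) (A A' : Ω → Finset ℝ) {M : ℝ} (hB : (B : ℝ) ≤ M)
    (hA : ∀ ω, 4 * ((A ω).card : ℝ) + 1 ≤ M) (hA' : ∀ ω, 4 * ((A' ω).card : ℝ) + 1 ≤ M)
    (hg : ∀ θ θ' ω, b θ = b θ' → SameCell (A ω) (x θ) (x θ') → SameCell (A' ω) (y θ) (y θ') →
      g θ ω = g θ' ω) : HasNets ν g M := by
  classical
  intro γ hγ hγ1
  have hM0 : 0 ≤ M := (Nat.cast_nonneg _).trans hB
  -- With `γ / 4` each exceptional event has probability at most `γ / 2`, so the union of the two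
  -- has at most `γ`. The cell counts `(M / γ) ^ 2`, `(M / γ) ^ 2` and `B ≤ M / γ` account for the
  -- exponent 5.
  obtain ⟨m, q, E, hm, hE, hq⟩ := exists_cells ν A (M := (M - 1) / 4) (γ := γ / 4)
    (fun ω => by have := hA ω; linarith) (by positivity)
  obtain ⟨m', q', E', hm', hE', hq'⟩ := exists_cells ν A' (M := (M - 1) / 4) (γ := γ / 4)
    (fun ω => by have := hA' ω; linarith) (by positivity)
  have hle : (M - 1) / 4 / (γ / 4) + 1 ≤ M / γ := by
    rw [div_div_div_cancel_right₀ (by norm_num), ← sub_nonneg]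
    have : M / γ - ((M - 1) / γ + 1) = (1 - γ) / γ := by field_simp; ring
    rw [this]
    exact div_nonneg (by linarith) hγ.le
  have hle0 : 0 ≤ (M - 1) / 4 / (γ / 4) + 1 := by
    have hΩ : Nonempty Ω := nonempty_of_isProbabilityMeasure ν
    have h1 : 1 ≤ M := by
      have h2 : (0 : ℝ) ≤ (A hΩ.some).card := Nat.cast_nonneg _
      linarith [hA hΩ.some]
    have : 0 ≤ M - 1 := by linarith
    positivity
  let e : Fin m × Fin m' × Fin B ≃ Fin (Fintype.card (Fin m × Fin m' × Fin B)) :=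
    Fintype.equivFin _
  let p : Θ → Fin m × Fin m' × Fin B := fun θ => (q (x θ), q' (y θ), b θ)
  -- `Function.invFun` picks a representative in each occupied cell; its value on unoccupied cells
  -- is arbitrary and never used.
  refine ⟨_, fun θ => e (p θ), fun i => Function.invFun p (e.symm i),
    fun i => E (e.symm i).1 ∪ E' (e.symm i).2.1, ?_, fun i => ?_, fun θ ω h => ?_⟩
  · simp only [Fintype.card_prod, Fintype.card_fin, Nat.cast_mul]
    calc (m : ℝ) * (m' * B) ≤ (M / γ) ^ 2 * ((M / γ) ^ 2 * (M / γ)) := by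
          gcongr
          · exact hm.trans (by gcongr)
          · exact hm'.trans (by gcongr)
          · exact hB.trans (le_div_self hM0 hγ hγ1)
      _ = _ := by ring
  · refine (measureReal_union_le _ _).trans ?_
    linarith [hE (e.symm i).1, hE' (e.symm i).2.1]
  · simp only [Equiv.symm_apply_apply, Set.mem_union, not_or] at h
    simp only [Equiv.symm_apply_apply]
    have hp : p (Function.invFun p (p θ)) = p θ := Function.invFun_eq ⟨θ, rfl⟩
    set θ' := Function.invFun p (p θ)
    simp only [p, Prod.mk.injEq] at hp h
    exact hg _ _ _ hp.2.2.symm (hq _ _ _ hp.1.symm h.1) (hq' _ _ _ hp.2.1.symm h.2)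

end Nets

/-! ### Combinatorics and counting of trees. -/

namespace DTree

variable {X : Type*}

/-- All node functions of the tree belong to `F`. -/
def NodesIn (F : Finset (X → Bool)) : DTree X → Prop
  | leaf => True
  | node f l r => f ∈ F ∧ l.NodesIn F ∧ r.NodesIn F

lemma numLeaves_leaf : (leaf : DTree X).numLeaves = 1 := rfl

lemma numLeaves_node (f : X → Bool) (l r : DTree X) :
    (node f l r).numLeaves = l.numLeaves + r.numLeaves := by
  rw [numLeaves, leaves, Finset.card_union_of_disjoint, Finset.card_image_of_injective _
    List.cons_injective, Finset.card_image_of_injective _ List.cons_injective]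
  · rfl
  · rw [Finset.disjoint_left]
    simp only [Finset.mem_image, not_exists, not_and]
    rintro _ ⟨p, -, rfl⟩ q - h
    simp at h

lemma one_le_numLeaves (T : DTree X) : 1 ≤ T.numLeaves := by
  induction T with
  | leaf => rfl
  | node f l r hl hr => rw [numLeaves_node]; omega

lemma leaves_nonempty (T : DTree X) : T.leaves.Nonempty :=
  Finset.card_pos.1 T.one_le_numLeaves

lemma numLeaves_splitLeaf (T : DTree X) (p : List Bool) (f : X → Bool) (hp : p ∈ T.leaves) :
    (T.splitLeaf p f).numLeaves = T.numLeaves + 1 := by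
  induction T generalizing p with
  | leaf =>
    rw [leaves, Finset.mem_singleton] at hp
    subst hp
    simp [splitLeaf, numLeaves_node, numLeaves_leaf]
  | node g l r hl hr =>
    simp only [leaves, Finset.mem_union, Finset.mem_image] at hp
    rcases hp with ⟨q, hq, rfl⟩ | ⟨q, hq, rfl⟩
    · rw [splitLeaf, numLeaves_node, numLeaves_node, hl q hq]; omega
    · rw [splitLeaf, numLeaves_node, numLeaves_node, hr q hq]; omega

lemma NodesIn.splitLeaf {F : Finset (X → Bool)} {T : DTree X} (hT : T.NodesIn F)
    {f : X → Bool} (hf : f ∈ F) (p : List Bool) : (T.splitLeaf p f).NodesIn F := by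
  induction T generalizing p with
  | leaf =>
    cases p with
    | nil => exact ⟨hf, trivial, trivial⟩
    | cons => exact trivial
  | node g l r hl hr =>
    obtain ⟨h1, h2, h3⟩ := hT
    match p with
    | [] => exact ⟨h1, h2, h3⟩
    | false :: p => exact ⟨h1, hl h2 p, h3⟩
    | true :: p => exact ⟨h1, h2, hr h3 p⟩

lemma NodesIn.route_congr {F : Finset (X → Bool)} {T : DTree X} (hT : T.NodesIn F) {x x' : X}
    (h : ∀ f ∈ F, f x = f x') : T.route x = T.route x' := by
  induction T with
  | leaf => rfl
  | node g l r hl hr =>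
    obtain ⟨h1, h2, h3⟩ := hT
    rw [route, route, h g h1, hl h2, hr h3]

lemma self_mem_prunings (T : DTree X) : T ∈ T.prunings := by
  classical
  induction T with
  | leaf => simp [prunings]
  | node f l r hl hr =>
    rw [prunings]
    exact Finset.mem_insert_of_mem (Finset.mem_image₂_of_mem hl hr)

lemma NodesIn.of_mem_prunings {F : Finset (X → Bool)} {T T' : DTree X} (hT : T.NodesIn F)
    (h : T' ∈ T.prunings) : T'.NodesIn F := by
  classical
  induction T generalizing T' with
  | leaf => rw [prunings, Finset.mem_singleton] at h; rw [h]; trivial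
  | node f l r hl hr =>
    rw [prunings, Finset.mem_insert, Finset.mem_image₂] at h
    rcases h with rfl | ⟨a, ha, b, hb, rfl⟩
    · trivial
    · exact ⟨hT.1, hl hT.2.1 ha, hr hT.2.2 hb⟩

lemma numLeaves_le_of_mem_prunings {T T' : DTree X} (h : T' ∈ T.prunings) :
    T'.numLeaves ≤ T.numLeaves := by
  classical
  induction T generalizing T' with
  | leaf => rw [prunings, Finset.mem_singleton] at h; rw [h]
  | node f l r hl hr =>
    rw [prunings, Finset.mem_insert, Finset.mem_image₂] at h
    rcases h with rfl | ⟨a, ha, b, hb, rfl⟩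
    · exact one_le_numLeaves _
    · rw [numLeaves_node, numLeaves_node]
      exact add_le_add (hl ha) (hr hb)

/-- A tree with `m` leaves has `m - 1` internal nodes, and collapsing is a choice at each of them.
In the induction the collapsed root adds one to a product of powers of two. -/
lemma card_prunings_le (T : DTree X) : T.prunings.card ≤ 2 ^ (T.numLeaves - 1) := by
  classical
  induction T with
  | leaf => simp [prunings, numLeaves_leaf]
  | node f l r hl hr =>
    rw [prunings, numLeaves_node]
    have h1 := one_le_numLeaves l
    have h2 := one_le_numLeaves r
    obtain ⟨a, ha⟩ := Nat.exists_eq_add_of_le h1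
    obtain ⟨b, hb⟩ := Nat.exists_eq_add_of_le h2
    rw [ha, Nat.add_sub_cancel_left] at hl
    rw [hb, Nat.add_sub_cancel_left] at hr
    rw [ha, hb, show 1 + a + (1 + b) - 1 = a + b + 1 by omega]
    refine (Finset.card_insert_le _ _).trans ?_
    have h3 := (Finset.card_image₂_le (node f) l.prunings r.prunings).trans
      (Nat.mul_le_mul hl hr)
    rw [← pow_add] at h3
    have := Nat.one_le_two_pow (n := a + b)
    rw [pow_succ]
    omega

open Classical in
/-- The trees which are obtained from a single leaf by a given number of splits with node functions
in `F`. -/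
noncomputable def reachable (F : Finset (X → Bool)) : ℕ → Finset (DTree X)
  | 0 => {leaf}
  | s + 1 => (reachable F s).biUnion fun T =>
      (T.leaves ×ˢ F).image fun q => T.splitLeaf q.1 q.2

lemma splitLeaf_mem_reachable {F : Finset (X → Bool)} {s : ℕ} {T : DTree X}
    (hT : T ∈ reachable F s) {q : List Bool × (X → Bool)} (hq : q ∈ T.leaves ×ˢ F) :
    T.splitLeaf q.1 q.2 ∈ reachable F (s + 1) := by
  classical
  rw [reachable]
  exact Finset.mem_biUnion.2 ⟨T, hT, Finset.mem_image.2 ⟨q, hq, rfl⟩⟩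

lemma numLeaves_nodesIn_of_mem_reachable {F : Finset (X → Bool)} {s : ℕ} {T : DTree X}
    (hT : T ∈ reachable F s) : T.numLeaves = s + 1 ∧ T.NodesIn F := by
  classical
  induction s generalizing T with
  | zero => rw [reachable, Finset.mem_singleton] at hT; rw [hT]; exact ⟨rfl, trivial⟩
  | succ s ih =>
    rw [reachable, Finset.mem_biUnion] at hT
    obtain ⟨T', hT', h⟩ := hT
    obtain ⟨q, hq, rfl⟩ := Finset.mem_image.1 h
    obtain ⟨hq1, hq2⟩ := Finset.mem_product.1 hq
    rw [numLeaves_splitLeaf _ _ _ hq1, (ih hT').1]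
    exact ⟨rfl, (ih hT').2.splitLeaf hq2 _⟩

/-- Each of the first `t` splits chooses one of at most `t` leaves and a function of `F`. -/
lemma card_reachable_le (F : Finset (X → Bool)) {s t : ℕ} (hst : s ≤ t) :
    (reachable F s).card ≤ (t * F.card) ^ s := by
  classical
  induction s with
  | zero => simp [reachable]
  | succ s ih =>
    rw [reachable, pow_succ]
    refine (Finset.card_biUnion_le_card_mul _ _ (t * F.card) fun T hT => ?_).trans
      (Nat.mul_le_mul_right _ (ih (by omega)))
    refine Finset.card_image_le.trans ?_
    rw [Finset.card_product]
    refine Nat.mul_le_mul_right _ ?_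
    have := (numLeaves_nodesIn_of_mem_reachable hT).1
    rw [numLeaves] at this
    omega

end DTree

/-! ### The grown and pruned trees, and the range of the objective. -/

section Growing

variable {X : Type*} {n c : ℕ}

lemma bestSplits_nonempty (g : (Fin c → ℝ) → ℝ) {F : Finset (X → Bool)} (hF : F.Nonempty)
    (T : DTree X) (D : Dataset X n c) : (bestSplits g F T D).Nonempty := by
  obtain ⟨q, hq, hmin⟩ := Finset.exists_min_image (T.leaves ×ˢ F)
    (fun q => splitFn g (T.splitLeaf q.1 q.2) D) (T.leaves_nonempty.product hF)
  exact ⟨q, Finset.mem_filter.2 ⟨hq, hmin⟩⟩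

lemma grow_mem_reachable (tb : TieBreaking X c) (g : (Fin c → ℝ) → ℝ) {F : Finset (X → Bool)}
    (hF : F.Nonempty) (D : Dataset X n c) (s : ℕ) :
    grow tb g F D s ∈ DTree.reachable F s := by
  induction s with
  | zero => simp [grow, DTree.reachable]
  | succ s ih =>
    exact DTree.splitLeaf_mem_reachable ih
      (Finset.mem_filter.1 (tb.split_mem _ _ (bestSplits_nonempty g hF _ D))).1

/-- The learner only depends on the comparisons between trees with equally many splits. -/
lemma grow_congr (tb : TieBreaking X c) {F : Finset (X → Bool)} (hF : F.Nonempty)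
    {g g' : (Fin c → ℝ) → ℝ} {D D' : Dataset X n c} {t : ℕ}
    (h : ∀ s < t, ∀ T ∈ DTree.reachable F (s + 1), ∀ T' ∈ DTree.reachable F (s + 1),
      (splitFn g T D ≤ splitFn g T' D ↔ splitFn g' T D' ≤ splitFn g' T' D')) {s : ℕ} (hs : s ≤ t) :
    grow tb g F D s = grow tb g' F D' s := by
  induction s with
  | zero => rfl
  | succ s ih =>
    have h1 := ih (by omega)
    have hmem := grow_mem_reachable tb g hF D s
    have h2 : bestSplits g F (grow tb g F D s) D = bestSplits g' F (grow tb g F D s) D' := by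
      refine Finset.filter_congr fun q hq => forall₂_congr fun q' hq' => ?_
      exact h s (by omega) _ (DTree.splitLeaf_mem_reachable hmem hq) _
        (DTree.splitLeaf_mem_reachable hmem hq')
    simp only [grow]
    rw [← h1, h2]

lemma bestPrunings_nonempty (tb : TieBreaking X c) (a : ℝ) (T : DTree X) (D : Dataset X n c) :
    (bestPrunings tb a T D).Nonempty := by
  obtain ⟨q, hq, hmin⟩ := Finset.exists_min_image T.prunings
    (fun T' => penalizedLoss tb a T' D) ⟨T, T.self_mem_prunings⟩
  exact ⟨q, Finset.mem_filter.2 ⟨hq, hmin⟩⟩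

lemma mccPrune_mem_bestPrunings (tb : TieBreaking X c) (a : ℝ) (T : DTree X)
    (D : Dataset X n c) : mccPrune tb a T D ∈ bestPrunings tb a T D :=
  tb.prune_mem _ _ _ (bestPrunings_nonempty tb a T D)

lemma loss_mem_Icc (tb : TieBreaking X c) (T : DTree X) (D : Dataset X n c) :
    loss tb T D ∈ Set.Icc 0 1 := by
  have h1 : (∑ i, if predict tb T D (D i).1 ≠ (D i).2 then (1 : ℝ) else 0) ≤ n := by
    calc _ ≤ ∑ _i : Fin n, (1 : ℝ) := Finset.sum_le_sum fun i _ => by split_ifs <;> norm_num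
      _ = n := by simp
  have h0 : 0 ≤ ∑ i, if predict tb T D (D i).1 ≠ (D i).2 then (1 : ℝ) else 0 :=
    Finset.sum_nonneg fun i _ => by split_ifs <;> norm_num
  refine ⟨mul_nonneg (by positivity) h0, ?_⟩
  rw [loss, one_div, inv_mul_eq_div]
  exact div_le_one_of_le₀ h1 n.cast_nonneg

lemma objective_mem_Icc (tb : TieBreaking X c) (κ : ℝ) {F : Finset (X → Bool)} (hF : F.Nonempty)
    (t : ℕ) {η : ℝ} (hη : 0 ≤ η) (ρ : Params) (D : Dataset X n c) :
    objective tb κ F t η ρ D ∈ Set.Icc η (η + (1 + η * t)) := by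
  have h1 := (Finset.mem_filter.1 (mccPrune_mem_bestPrunings tb ρ.αPrune
    (grow tb (tsallis κ ρ.α ρ.β) F D t) D)).1
  have h2 := DTree.numLeaves_le_of_mem_prunings h1
  rw [(DTree.numLeaves_nodesIn_of_mem_reachable (grow_mem_reachable tb _ hF D t)).1] at h2
  have h3 := DTree.one_le_numLeaves (learnedTree tb κ F t ρ D)
  have h4 := loss_mem_Icc tb (learnedTree tb κ F t ρ D) D
  have h2' : ((learnedTree tb κ F t ρ D).numLeaves : ℝ) ≤ t + 1 := by exact_mod_cast h2
  have h3' : (1 : ℝ) ≤ (learnedTree tb κ F t ρ D).numLeaves := by exact_mod_cast h3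
  rw [objective, penalizedLoss]
  constructor
  · nlinarith [h4.1]
  · nlinarith [h4.2]

end Growing

/-! ### Reduction to finitely many datasets. -/

section Coding

variable {X : Type*} {n c : ℕ}

/-- Two datasets which the functions in `F` and the labels do not distinguish. -/
def Indist (F : Finset (X → Bool)) (D D' : Dataset X n c) : Prop :=
  ∀ i, (∀ f ∈ F, f (D i).1 = f (D' i).1) ∧ (D i).2 = (D' i).2

variable {F : Finset (X → Bool)} {D D' : Dataset X n c} {T : DTree X}

lemma Indist.weight_eq (h : Indist F D D') (hT : T.NodesIn F) : weight T D = weight T D' := by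
  funext p
  simp only [weight, fun i => hT.route_congr (h i).1]

lemma Indist.labelCount_eq (h : Indist F D D') (hT : T.NodesIn F) :
    labelCount T D = labelCount T D' := by
  funext p k
  simp only [labelCount, fun i => hT.route_congr (h i).1, fun i => (h i).2]

lemma Indist.splitFn_eq (h : Indist F D D') (hT : T.NodesIn F) (g : (Fin c → ℝ) → ℝ) :
    splitFn g T D = splitFn g T D' := by
  simp only [splitFn, h.weight_eq hT, h.labelCount_eq hT]

lemma Indist.penalizedLoss_eq (h : Indist F D D') (hT : T.NodesIn F) (tb : TieBreaking X c)
    (a : ℝ) : penalizedLoss tb a T D = penalizedLoss tb a T D' := by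
  have h1 : modes T D = modes T D' := by
    funext p
    refine Finset.filter_congr fun k _ => ?_
    rw [h.labelCount_eq hT]
  have h2 : ∀ i, predict tb T D (D i).1 = predict tb T D' (D' i).1 := fun i => by
    rw [predict, predict, h1, hT.route_congr (h i).1]
  rw [penalizedLoss, penalizedLoss, loss, loss,
    Finset.sum_congr rfl fun i _ => by rw [h2 i, (h i).2]]

/-- Growing, pruning and loss use a point only through its label and its route in trees with nodes
in `F`. Consequently the objective factors through the finite-valued map `code`. -/
lemma Indist.objective_eq (h : Indist F D D') (hF : F.Nonempty) (tb : TieBreaking X c) (κ : ℝ)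
    (t : ℕ) (η : ℝ) (ρ : Params) :
    objective tb κ F t η ρ D = objective tb κ F t η ρ D' := by
  have h1 : grow tb (tsallis κ ρ.α ρ.β) F D t = grow tb (tsallis κ ρ.α ρ.β) F D' t :=
    grow_congr tb hF (fun s _ T hT T' hT' => by
      rw [h.splitFn_eq (DTree.numLeaves_nodesIn_of_mem_reachable hT).2,
        h.splitFn_eq (DTree.numLeaves_nodesIn_of_mem_reachable hT').2]) le_rfl
  have hT := (DTree.numLeaves_nodesIn_of_mem_reachable
    (grow_mem_reachable tb (tsallis κ ρ.α ρ.β) hF D t)).2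
  set T := grow tb (tsallis κ ρ.α ρ.β) F D t with hTdef
  have h2 : bestPrunings tb ρ.αPrune T D = bestPrunings tb ρ.αPrune T D' :=
    Finset.filter_congr fun T' hT' => forall₂_congr fun T'' hT'' => by
      rw [h.penalizedLoss_eq (hT.of_mem_prunings hT'), h.penalizedLoss_eq (hT.of_mem_prunings hT'')]
  have h3 : mccPrune tb ρ.αPrune T D = mccPrune tb ρ.αPrune T D' := by
    rw [mccPrune, mccPrune, h2]
  have h4 := hT.of_mem_prunings
    (Finset.mem_filter.1 (mccPrune_mem_bestPrunings tb ρ.αPrune T D)).1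
  rw [objective, objective, learnedTree, learnedTree, ← h1, ← hTdef, ← h3, h.penalizedLoss_eq h4]

end Coding

/-! ### Sums of powers as functions of the exponent. -/

/-- On the positive reals, `h` is a combination of at most `n` powers `x ↦ u ^ x` with `u ≥ 0`. -/
def IsPowSum (h : ℝ → ℝ) (n : ℕ) : Prop :=
  ∃ (ι : Type) (_ : Fintype ι) (a u : ι → ℝ), Fintype.card ι ≤ n ∧ (∀ j, 0 ≤ u j) ∧
    ∀ x : ℝ, 0 < x → h x = ∑ j, a j * u j ^ x

namespace IsPowSum

lemma const (r : ℝ) : IsPowSum (fun _ => r) 1 :=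
  ⟨Unit, inferInstance, fun _ => r, fun _ => 1, by simp, by simp, by simp⟩

lemma mono {h : ℝ → ℝ} {n m : ℕ} (hh : IsPowSum h n) (hnm : n ≤ m) : IsPowSum h m := by
  obtain ⟨ι, i, a, u, hc, hu, he⟩ := hh
  exact ⟨ι, i, a, u, hc.trans hnm, hu, he⟩

lemma add {h h' : ℝ → ℝ} {n n' : ℕ} (hh : IsPowSum h n) (hh' : IsPowSum h' n') :
    IsPowSum (fun x => h x + h' x) (n + n') := by
  obtain ⟨ι, _, a, u, hc, hu, he⟩ := hh
  obtain ⟨ι', _, a', u', hc', hu', he'⟩ := hh'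
  refine ⟨ι ⊕ ι', inferInstance, Sum.elim a a', Sum.elim u u', ?_, ?_, fun x hx => ?_⟩
  · rw [Fintype.card_sum]; exact add_le_add hc hc'
  · rintro (j | j)
    exacts [hu j, hu' j]
  · simp only [Fintype.sum_sum_type, Sum.elim_inl, Sum.elim_inr, he x hx, he' x hx]

lemma const_mul {h : ℝ → ℝ} {n : ℕ} (hh : IsPowSum h n) (r : ℝ) :
    IsPowSum (fun x => r * h x) n := by
  obtain ⟨ι, _, a, u, hc, hu, he⟩ := hh
  refine ⟨ι, inferInstance, fun j => r * a j, u, hc, hu, fun x hx => ?_⟩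
  simp only [he x hx, Finset.mul_sum, mul_assoc]

lemma sub {h h' : ℝ → ℝ} {n n' : ℕ} (hh : IsPowSum h n) (hh' : IsPowSum h' n') :
    IsPowSum (fun x => h x - h' x) (n + n') := by
  simpa [sub_eq_add_neg] using hh.add (hh'.const_mul (-1))

lemma sum {ι : Type*} (J : Finset ι) {h : ι → ℝ → ℝ} {n : ℕ} (hh : ∀ j ∈ J, IsPowSum (h j) n) :
    IsPowSum (fun x => ∑ j ∈ J, h j x) (J.card * n) := by
  classical
  induction J using Finset.induction_on with
  | empty =>
    simp only [Finset.sum_empty, Finset.card_empty, zero_mul]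
    exact ⟨Empty, inferInstance, Empty.elim, Empty.elim, by simp, by simp, by simp⟩
  | insert i J hi ih =>
    simp only [Finset.sum_insert hi, Finset.card_insert_of_notMem hi]
    rw [add_mul, one_mul, add_comm]
    exact (hh i (Finset.mem_insert_self _ _)).add
      (ih fun j hj => hh j (Finset.mem_insert_of_mem hj))

/-- Powers of sums of powers are expanded by the multinomial theorem. -/
lemma sum_rpow_pow {c : ℕ} (p : Fin c → ℝ) (hp : ∀ i, 0 ≤ p i) (β : ℕ) :
    IsPowSum (fun x => (∑ i, p i ^ x) ^ β) ((β + 1) ^ c) := by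
  -- The exponent vector `k` contributes the base `∏ i, p i ^ k i` with its multinomial coefficient;
  -- each entry of `k` is at most `β`.
  refine ⟨{k // k ∈ Finset.piAntidiag (Finset.univ : Finset (Fin c)) β}, inferInstance,
    fun k => Nat.multinomial Finset.univ k.1, fun k => ∏ i, p i ^ k.1 i, ?_,
    fun k => Finset.prod_nonneg fun i _ => pow_nonneg (hp i) _, fun x _ => ?_⟩
  · rw [Fintype.card_coe]
    calc (Finset.piAntidiag (Finset.univ : Finset (Fin c)) β).card
        ≤ (Fintype.piFinset fun _ : Fin c => Finset.range (β + 1)).card := by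
          refine Finset.card_le_card fun k hk => ?_
          rw [Finset.mem_piAntidiag] at hk
          rw [Fintype.mem_piFinset]
          intro i
          rw [Finset.mem_range, Nat.lt_succ_iff, ← hk.1]
          exact Finset.single_le_sum (fun _ _ => Nat.zero_le _) (Finset.mem_univ i)
      _ = (β + 1) ^ c := by simp
  · dsimp only
    rw [Finset.sum_pow_eq_sum_piAntidiag, ← Finset.sum_coe_sort]
    refine Finset.sum_congr rfl fun k _ => ?_
    rw [← Real.finsetProd_rpow _ _ fun i _ => pow_nonneg (hp i) _]
    congr 1
    refine Finset.prod_congr rfl fun i _ => ?_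
    rw [← Real.rpow_natCast, ← Real.rpow_natCast, ← Real.rpow_mul (hp i), ← Real.rpow_mul (hp i),
      mul_comm]

lemma continuousOn {h : ℝ → ℝ} {n : ℕ} (hh : IsPowSum h n) : ContinuousOn h (Set.Ioi 0) := by
  obtain ⟨ι, _, a, u, -, -, he⟩ := hh
  refine ContinuousOn.congr (continuousOn_finsetSum _ fun j _ => ?_) fun x hx => he x hx
  exact continuousOn_const.mul fun x hx =>
    (Real.continuousAt_const_rpow' (ne_of_gt hx)).continuousWithinAt

/-- A combination of `n` powers has a constant sign on the cells between `n` breakpoints. -/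
lemma exists_breakpoints {h : ℝ → ℝ} {n : ℕ} (hh : IsPowSum h n) :
    ∃ Z : Finset ℝ, Z.card ≤ n ∧ ∀ x y : ℝ, 0 < x → 0 < y → SameCell Z x y →
      (h x ≤ 0 → h y ≤ 0) ∧ (0 ≤ h x → 0 ≤ h y) := by
  have hc := hh.continuousOn
  obtain ⟨ι, _, a, u, hn, hu, he⟩ := hh
  rcases powSum_eq_zero_or_card_zeros_le Finset.univ a u fun j _ => hu j with h0 | ⟨Z, hZ, hz⟩
  · refine ⟨∅, by simp, fun x y _ hy _ => ?_⟩
    rw [he y hy, h0 y hy]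
    exact ⟨fun _ => le_rfl, fun _ => le_rfl⟩
  · refine ⟨Z, hZ.trans hn, fun x y hx hy hxy => ⟨?_, fun h1 => ?_⟩⟩
    · exact hxy.nonpos_of_nonpos hc (fun w hw h2 => (hz w hw).1 ((he w hw).symm.trans h2)) hx hy
    · have := hxy.nonpos_of_nonpos (h := fun x => - h x) hc.neg
        (fun w hw h2 => (hz w hw).1 ((he w hw).symm.trans (neg_eq_zero.1 h2))) hx hy
        (by linarith)
      linarith

end IsPowSum

/-! ### Breakpoints of the learner. -/

section Breakpoints

variable {X : Type*} {n c : ℕ}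

/-- Comparisons of trees by the Tsallis entropy change only at few values of `α`. -/
lemma exists_breakpoints_splitFn {κ : ℝ} (hκ : 0 < κ) {β B : ℕ} (hβ : β ≤ B) (D : Dataset X n c)
    {T T' : DTree X} {s : ℕ} (hT : T.numLeaves ≤ s) (hT' : T'.numLeaves ≤ s) :
    ∃ Z : Finset ℝ, Z.card ≤ 2 * (s * (1 + (B + 1) ^ c)) ∧
      ∀ x y : ℝ, 0 < x → 0 < y → SameCell (insert 1 Z) x y →
        (splitFn (tsallis κ x β) T D ≤ splitFn (tsallis κ x β) T' D →
          splitFn (tsallis κ y β) T D ≤ splitFn (tsallis κ y β) T' D) := by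
  let φ : DTree X → ℝ → ℝ := fun T x => ∑ p ∈ T.leaves, (weight T D p : ℝ) *
    (1 - (∑ k, ((labelCount T D p k : ℝ) / (weight T D p : ℝ)) ^ x) ^ β)
  have hφ : ∀ T : DTree X, T.numLeaves ≤ s → IsPowSum (φ T) (s * (1 + (B + 1) ^ c)) := by
    intro T hT
    refine (IsPowSum.sum T.leaves (n := 1 + (B + 1) ^ c) fun p _ => ?_).mono
      (Nat.mul_le_mul_right _ hT)
    refine IsPowSum.const_mul (((IsPowSum.const 1).sub
      (IsPowSum.sum_rpow_pow _ (fun k => by positivity) β)).mono ?_) _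
    gcongr
  have hsplit : ∀ (T : DTree X) (x : ℝ), x ≠ 1 →
      splitFn (tsallis κ x β) T D = κ / (x - 1) * φ T x := by
    intro T x hx
    simp only [splitFn, tsallis, if_neg hx, φ, Finset.mul_sum]
    exact Finset.sum_congr rfl fun p _ => by ring
  obtain ⟨Z, hZ, hz⟩ := ((hφ T' hT').sub (hφ T hT)).exists_breakpoints
  refine ⟨Z, by rw [two_mul]; exact hZ, fun x y hx hy hxy hle => ?_⟩
  have h1 := hxy 1 (Finset.mem_insert_self _ _)
  have h2 := hxy.lt_iff (Finset.mem_insert_self _ _)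
  have h3 := hz x y hx hy (hxy.mono (Finset.subset_insert _ _))
  -- The factor `κ / (x - 1)` changes sign at 1, hence the extra breakpoint there. It also makes
  -- `{1}` a cell of its own, so the entropy formula at `α = 1` needs no analysis.
  rcases lt_trichotomy x 1 with h | h | h
  · have h' := h2.1 h
    have hx' : κ / (x - 1) < 0 := div_neg_of_pos_of_neg hκ (by linarith)
    have hy' : κ / (y - 1) < 0 := div_neg_of_pos_of_neg hκ (by linarith)
    rw [hsplit _ _ h.ne, hsplit _ _ h.ne, mul_le_mul_left_of_neg hx'] at hle
    rw [hsplit _ _ h'.ne, hsplit _ _ h'.ne, mul_le_mul_left_of_neg hy']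
    have := h3.1 (by linarith)
    linarith
  · rwa [← h1.2.1 h.symm, ← h]
  · have h' := h1.1.1 h
    have hx' : 0 < κ / (x - 1) := div_pos hκ (by linarith)
    have hy' : 0 < κ / (y - 1) := div_pos hκ (by linarith)
    rw [hsplit _ _ h.ne', hsplit _ _ h.ne', mul_le_mul_iff_right₀ hx'] at hle
    rw [hsplit _ _ h'.ne', hsplit _ _ h'.ne', mul_le_mul_iff_right₀ hy']
    have := h3.2 (by linarith)
    linarith

/-- The grown tree changes only at few values of `α`. -/
lemma exists_breakpoints_grow (tb : TieBreaking X c) {κ : ℝ} (hκ : 0 < κ) {F : Finset (X → Bool)}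
    (hF : F.Nonempty) (B t : ℕ) (D : Dataset X n c) :
    ∃ A : Finset ℝ, A.card ≤ 1 + B * (t * (((t * F.card) ^ t * (t * F.card) ^ t) *
        (2 * ((t + 1) * (1 + (B + 1) ^ c))))) ∧
      ∀ β, 1 ≤ β → β ≤ B → ∀ x y : ℝ, 0 < x → 0 < y → SameCell A x y →
        grow tb (tsallis κ x β) F D t = grow tb (tsallis κ y β) F D t := by
  classical
  have h1 : ∀ (β : ℕ) (p : DTree X × DTree X), ∃ Z : Finset ℝ,
      Z.card ≤ 2 * ((t + 1) * (1 + (B + 1) ^ c)) ∧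
      (β ≤ B → p.1.numLeaves ≤ t + 1 → p.2.numLeaves ≤ t + 1 →
      ∀ x y : ℝ, 0 < x → 0 < y → SameCell (insert 1 Z) x y →
        (splitFn (tsallis κ x β) p.1 D ≤ splitFn (tsallis κ x β) p.2 D →
          splitFn (tsallis κ y β) p.1 D ≤ splitFn (tsallis κ y β) p.2 D)) := by
    intro β p
    by_cases h : β ≤ B ∧ p.1.numLeaves ≤ t + 1 ∧ p.2.numLeaves ≤ t + 1
    · obtain ⟨Z, hZ, hz⟩ := exists_breakpoints_splitFn hκ h.1 D h.2.1 h.2.2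
      exact ⟨Z, hZ, fun _ _ _ => hz⟩
    · exact ⟨∅, by simp, fun ha hb hc => absurd ⟨ha, hb, hc⟩ h⟩
  choose Z hZ hz using h1
  refine ⟨insert 1 ((Finset.Icc 1 B).biUnion fun β => (Finset.range t).biUnion fun s =>
    (DTree.reachable F (s + 1) ×ˢ DTree.reachable F (s + 1)).biUnion fun p => Z β p), ?_, ?_⟩
  · refine (Finset.card_insert_le _ _).trans ?_
    rw [add_comm]
    refine Nat.add_le_add_left ?_ _
    refine (Finset.card_biUnion_le_card_mul _ _ (t * (((t * F.card) ^ t * (t * F.card) ^ t) *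
        (2 * ((t + 1) * (1 + (B + 1) ^ c))))) fun β _ => le_trans (
      Finset.card_biUnion_le_card_mul _ _ _ fun s hs =>
        (Finset.card_biUnion_le_card_mul _ _ _ fun p _ => hZ β p).trans
          (Nat.mul_le_mul_right _ ?_)) (by rw [Finset.card_range])).trans (by simp)
    have hs' := Finset.mem_range.1 hs
    have hpos : 0 < t * F.card := Nat.mul_pos (by omega) hF.card_pos
    have := (DTree.card_reachable_le F (show s + 1 ≤ t by omega)).trans
      (Nat.pow_le_pow_right hpos (show s + 1 ≤ t by omega))
    rw [Finset.card_product]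
    exact Nat.mul_le_mul this this
  · intro β hβ1 hβ x y hx hy hxy
    refine grow_congr tb hF (fun s hs T hT T' hT' => ?_) le_rfl
    have hsub : SameCell (insert 1 (Z β (T, T'))) x y := by
      refine hxy.mono (Finset.insert_subset_insert _ fun z h => ?_)
      simp only [Finset.mem_biUnion]
      exact ⟨β, Finset.mem_Icc.2 ⟨hβ1, hβ⟩, s, Finset.mem_range.2 hs, (T, T'),
        Finset.mem_product.2 ⟨hT, hT'⟩, h⟩
    have hT1 : T.numLeaves ≤ t + 1 := by
      rw [(DTree.numLeaves_nodesIn_of_mem_reachable hT).1]; omega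
    have hT2 : T'.numLeaves ≤ t + 1 := by
      rw [(DTree.numLeaves_nodesIn_of_mem_reachable hT').1]; omega
    exact ⟨hz β (T, T') hβ hT1 hT2 x y hx hy hsub, hz β (T, T') hβ hT1 hT2 y x hy hx hsub.symm⟩

/-- The objective of the pruned tree changes only at few values of the complexity parameter:
elsewhere all minimizers have the same loss and the same number of leaves. -/
lemma exists_breakpoints_mccPrune (tb : TieBreaking X c) (F : Finset (X → Bool)) (t : ℕ) (η : ℝ)
    (D : Dataset X n c) :
    ∃ A : Finset ℝ, A.card ≤ (t * F.card) ^ t * (2 ^ t * 2 ^ t) ∧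
      ∀ T ∈ DTree.reachable F t, ∀ x y : ℝ, SameCell A x y →
        penalizedLoss tb η (mccPrune tb x T D) D = penalizedLoss tb η (mccPrune tb y T D) D := by
  classical
  -- The complexity parameter at which two prunings have equal cost. For equal numbers of leaves,
  -- division by zero gives the value 0, a harmless extra breakpoint.
  let z : DTree X × DTree X → ℝ := fun p =>
    (loss tb p.2 D - loss tb p.1 D) / ((p.1.numLeaves : ℝ) - p.2.numLeaves)
  refine ⟨(DTree.reachable F t).biUnion fun T => (T.prunings ×ˢ T.prunings).image z, ?_, ?_⟩
  · refine (Finset.card_biUnion_le_card_mul _ _ (2 ^ t * 2 ^ t) fun T hT => ?_).trans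
      (Nat.mul_le_mul_right _ (DTree.card_reachable_le F le_rfl))
    have := T.card_prunings_le
    rw [(DTree.numLeaves_nodesIn_of_mem_reachable hT).1, Nat.add_sub_cancel] at this
    refine Finset.card_image_le.trans ?_
    rw [Finset.card_product]
    exact Nat.mul_le_mul this this
  · intro T hT x y hxy
    by_cases hx : x ∈ (DTree.reachable F t).biUnion fun T => (T.prunings ×ˢ T.prunings).image z
    · rw [(hxy x hx).2.1 rfl]
    have hmem : ∀ T' ∈ T.prunings, ∀ T'' ∈ T.prunings, z (T', T'') ∈
        (DTree.reachable F t).biUnion fun T => (T.prunings ×ˢ T.prunings).image z :=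
      fun T' h' T'' h'' => Finset.mem_biUnion.2 ⟨T, hT, Finset.mem_image_of_mem _
        (Finset.mem_product.2 ⟨h', h''⟩)⟩
    have hcomp : ∀ T' ∈ T.prunings, ∀ T'' ∈ T.prunings,
        (penalizedLoss tb x T' D ≤ penalizedLoss tb x T'' D ↔
          penalizedLoss tb y T' D ≤ penalizedLoss tb y T'' D) := by
      intro T' h' T'' h''
      have h1 := hxy _ (hmem T' h' T'' h'')
      have h2 := hxy.lt_iff (hmem T' h' T'' h'')
      have key : ∀ w : ℝ, penalizedLoss tb w T' D ≤ penalizedLoss tb w T'' D ↔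
          w * ((T'.numLeaves : ℝ) - T''.numLeaves) ≤ loss tb T'' D - loss tb T' D := fun w => by
        simp only [penalizedLoss]
        constructor <;> intro h <;> linarith
      rw [key, key]
      rcases lt_trichotomy ((T'.numLeaves : ℝ) - T''.numLeaves) 0 with h | h | h
      · rw [← div_le_iff_of_neg h, ← div_le_iff_of_neg h, ← not_lt, ← not_lt]
        exact not_congr h2
      · rw [h, mul_zero, mul_zero]
      · rw [← le_div_iff₀ h, ← le_div_iff₀ h, ← not_lt, ← not_lt]
        exact not_congr h1.1
    have hbest : bestPrunings tb x T D = bestPrunings tb y T D :=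
      Finset.filter_congr fun T' h' => forall₂_congr fun T'' h'' => hcomp T' h' T'' h''
    have hm1 := mccPrune_mem_bestPrunings tb x T D
    have hm2 := mccPrune_mem_bestPrunings tb y T D
    rw [← hbest] at hm2
    -- The selected prunings may differ, because the tie-breaking rule sees the complexity
    -- parameter. Both minimize the cost at `x`, which is not a breakpoint, so they have equally
    -- many leaves and hence equal loss.
    set T' := mccPrune tb x T D
    set T'' := mccPrune tb y T D
    obtain ⟨h1, h1'⟩ := Finset.mem_filter.1 hm1
    obtain ⟨h2, h2'⟩ := Finset.mem_filter.1 hm2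
    have heq : penalizedLoss tb x T' D = penalizedLoss tb x T'' D :=
      le_antisymm (h1' _ h2) (h2' _ h1)
    simp only [penalizedLoss] at heq ⊢
    by_cases hs : (T'.numLeaves : ℝ) - T''.numLeaves = 0
    · have hs' : (T'.numLeaves : ℝ) = T''.numLeaves := by linarith
      rw [hs'] at heq ⊢
      linarith
    · refine absurd (hmem T' h1 T'' h2) ?_
      have : z (T', T'') = x := by
        simp only [z]
        rw [div_eq_iff hs]
        linarith
      rwa [this]

end Breakpoints

/-- Both numbers of breakpoints are bounded by a power of `t |F| (B + c) ^ c`. -/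
lemma breakpoint_count_le {t f B c : ℕ} (ht : 1 ≤ t) (hf : 1 ≤ f) (hB : 1 ≤ B) (hc : 1 ≤ c) :
    2 ≤ t * f * (B + c) ^ c ∧ B ≤ (t * f * (B + c) ^ c) ^ (13 * t) ∧
      4 * (1 + B * (t * (((t * f) ^ t * (t * f) ^ t) *
        (2 * ((t + 1) * (1 + (B + 1) ^ c)))))) + 1 ≤ (t * f * (B + c) ^ c) ^ (13 * t) ∧
      4 * ((t * f) ^ t * (2 ^ t * 2 ^ t)) + 1 ≤ (t * f * (B + c) ^ c) ^ (13 * t) := by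
  set R := t * f * (B + c) ^ c with hR
  have htf : 1 ≤ t * f := Nat.mul_pos ht hf
  have hBc0 : B + c ≤ (B + c) ^ c := Nat.le_self_pow (by omega) _
  have hBcR : (B + c) ^ c ≤ R := Nat.le_mul_of_pos_left _ htf
  have htfR : t * f ≤ R := Nat.le_mul_of_pos_right _ (by positivity)
  have htR : t ≤ R := (Nat.le_mul_of_pos_right t hf).trans htfR
  have hBR : B ≤ R := by omega
  have h2 : 2 ≤ R := by omega
  have hB1 : (B + 1) ^ c ≤ R := (Nat.pow_le_pow_left (by omega) c).trans hBcR
  have hpow : ∀ {a b : ℕ}, a ≤ b → R ^ a ≤ R ^ b := fun h => Nat.pow_le_pow_right (by omega) h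
  have hfour : ∀ {a e : ℕ}, a ≤ R ^ e → 4 * a + 1 ≤ R ^ (e + 3) := by
    intro a e h
    have h8 : 2 ^ 3 ≤ R ^ 3 := Nat.pow_le_pow_left h2 3
    have h1 : 1 ≤ R ^ e := Nat.one_le_pow _ _ (by omega)
    calc 4 * a + 1 ≤ R ^ e * 2 ^ 3 := by omega
      _ ≤ R ^ (e + 3) := by rw [pow_add]; exact Nat.mul_le_mul_left _ h8
  refine ⟨h2, hBR.trans (Nat.le_self_pow (by omega) _), ?_, ?_⟩
  · have h3 : B * (t * (((t * f) ^ t * (t * f) ^ t) *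
        (2 * ((t + 1) * (1 + (B + 1) ^ c))))) ≤ R ^ (2 * t + 7) := by
      calc _ ≤ R * (R * ((R ^ t * R ^ t) * (R * ((R * R) * (R * R))))) := by
            gcongr
            · nlinarith
            · nlinarith
        _ = _ := by ring
    have h4 : 1 + B * (t * (((t * f) ^ t * (t * f) ^ t) *
        (2 * ((t + 1) * (1 + (B + 1) ^ c))))) ≤ R ^ (2 * t + 8) := by
      have h1 : 1 ≤ R ^ (2 * t + 7) := Nat.one_le_pow _ _ (by omega)
      have : R ^ (2 * t + 7) * 2 ≤ R ^ (2 * t + 8) := by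
        rw [pow_succ R (2 * t + 7)]; exact Nat.mul_le_mul_left _ h2
      omega
    exact (hfour h4).trans (hpow (by omega))
  · have h3 : (t * f) ^ t * (2 ^ t * 2 ^ t) ≤ R ^ (3 * t) := by
      calc _ ≤ R ^ t * (R ^ t * R ^ t) := by gcongr
        _ = _ := by ring
    exact (hfour h3).trans (hpow (by omega))

/-! ### Existence of minimizers, and nets for the objective. -/

section Tuning

variable {X : Type*} {n c : ℕ}

/-- Empirical risk minimizers exist, because only finitely many trees can be learned. -/
lemma exists_isERM (tb : TieBreaking X c) (κ : ℝ) {F : Finset (X → Bool)} (hF : F.Nonempty)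
    (t : ℕ) (η : ℝ) {B : ℕ} (hB : 1 ≤ B) {N : ℕ} (S : Fin N → Dataset X n c) :
    ∃ ρ : Params, IsERM tb κ F t η B S ρ := by
  classical
  let 𝓣 : Finset (DTree X) := (DTree.reachable F t).biUnion fun T => T.prunings
  let Φ : Params → ℝ := fun ρ => ∑ j, objective tb κ F t η ρ (S j)
  have hfin : (Φ '' {ρ | ρ.Admissible B}).Finite := by
    refine ((Fintype.piFinset fun _ : Fin N => 𝓣).image fun V =>
      ∑ j, penalizedLoss tb η (V j) (S j)).finite_toSet.subset ?_
    rintro _ ⟨ρ, -, rfl⟩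
    refine Finset.mem_coe.2 (Finset.mem_image.2 ⟨fun j => learnedTree tb κ F t ρ (S j), ?_, rfl⟩)
    refine Fintype.mem_piFinset.2 fun j => Finset.mem_biUnion.2
      ⟨_, grow_mem_reachable tb (tsallis κ ρ.α ρ.β) hF (S j) t, ?_⟩
    exact (Finset.mem_filter.1 (mccPrune_mem_bestPrunings tb _ _ _)).1
  obtain ⟨_, ⟨ρ, hρ, rfl⟩, hmin⟩ := Set.exists_min_image _ id hfin
    ⟨_, ⟨⟨1, 1, 0⟩, ⟨one_pos, ⟨le_rfl, hB⟩, le_rfl⟩, rfl⟩⟩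
  exact ⟨ρ, hρ, fun ρ' hρ' => hmin _ ⟨ρ', hρ', rfl⟩⟩

/-- What a dataset looks like to the functions in `F`. -/
def code (F : Finset (X → Bool)) (D : Dataset X n c) : Fin n → ({f // f ∈ F} → Bool) × Fin c :=
  fun i => (fun f => f.1 (D i).1, (D i).2)

lemma measurable_code [MeasurableSpace X] {F : Finset (X → Bool)}
    (hF : ∀ f ∈ F, Measurable f) : Measurable (code F : Dataset X n c → _) :=
  measurable_pi_lambda _ fun i => Measurable.prodMk
    (measurable_pi_lambda _ fun f =>
      (hF f.1 f.2).comp (measurable_fst.comp (measurable_pi_apply i)))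
    (measurable_snd.comp (measurable_pi_apply i))

lemma indist_of_code_eq {F : Finset (X → Bool)} {D D' : Dataset X n c}
    (h : code F D = code F D') : Indist F D D' := fun i => by
  have h1 := congrFun h i
  simp only [code, Prod.mk.injEq] at h1
  exact ⟨fun f hf => congrFun h1.1 ⟨f, hf⟩, h1.2⟩

/-- The objective, normalized to take values in the unit interval, has small nets. -/
lemma hasNets_objective {Ω : Type*} [Finite Ω] [MeasurableSpace Ω] [MeasurableSingletonClass Ω]
    (ν : Measure Ω) [IsProbabilityMeasure ν] (D : Ω → Dataset X n c) (tb : TieBreaking X c) {κ : ℝ}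
    (hκ : 0 < κ) {F : Finset (X → Bool)} (hF : F.Nonempty) {t B : ℕ} (ht : 1 ≤ t) (hB : 1 ≤ B)
    (hc : 1 ≤ c) (η : ℝ) (ψ : ℝ → ℝ) :
    HasNets ν (fun (θ : {ρ : Params // ρ.Admissible B}) ω =>
      ψ (objective tb κ F t η θ.1 (D ω))) (((t * F.card * (B + c) ^ c) ^ (13 * t) : ℕ) : ℝ) := by
  obtain ⟨-, hBM, hM, hM'⟩ := breakpoint_count_le ht hF.card_pos hB hc
  choose A hA hA1 using fun ω => exists_breakpoints_grow tb hκ hF B t (D ω)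
  choose A' hA' hA1' using fun ω => exists_breakpoints_mccPrune tb F t η (D ω)
  have : Nonempty {ρ : Params // ρ.Admissible B} :=
    ⟨⟨⟨1, 1, 0⟩, ⟨one_pos, ⟨le_rfl, hB⟩, le_rfl⟩⟩⟩
  refine hasNets_of_breakpoints ν (B := B) (fun θ => θ.1.α) (fun θ => θ.1.αPrune)
    (fun θ => ⟨θ.1.β - 1, by have := θ.2.2.1; omega⟩) _ A A' (by exact_mod_cast hBM)
    (fun ω => ?_) (fun ω => ?_) fun θ θ' ω hb hx hy => ?_
  · exact_mod_cast (Nat.add_le_add_right (Nat.mul_le_mul_left 4 (hA ω)) 1).trans hM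
  · exact_mod_cast (Nat.add_le_add_right (Nat.mul_le_mul_left 4 (hA' ω)) 1).trans hM'
  · have hβ : θ.1.β = θ'.1.β := by
      have h1 := θ.2.2.1
      have h2 := θ'.2.2.1
      simp only [Fin.mk.injEq] at hb
      omega
    have h1 := hA1 ω θ.1.β θ.2.2.1.1 θ.2.2.1.2 _ _ θ.2.1 θ'.2.1 hx
    simp only [objective, learnedTree]
    rw [← hβ, ← h1, hA1' ω _ (grow_mem_reachable tb _ hF _ t) _ _ hy]

end Tuning

end TreeTuning

/-! ### The sample complexity theorem. -/

theorem mainTheorem2 :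
    ∃ K : ℝ, 0 < K ∧
      ∀ (X : Type*) [MeasurableSpace X] (n c t B : ℕ), 1 ≤ n → 1 ≤ c → 1 ≤ t → 1 ≤ B →
      ∀ (F : Finset (X → Bool)), F.Nonempty → (∀ f ∈ F, Measurable f) →
      ∀ (tb : TreeTuning.TieBreaking X c) (κ : ℝ), 0 < κ →
      ∀ (η : ℝ), 0 ≤ η →
      ∀ (μ : MeasureTheory.Measure (TreeTuning.Dataset X n c))
        [MeasureTheory.IsProbabilityMeasure μ],
        (∀ ρ : TreeTuning.Params, ρ.Admissible B →
          MeasureTheory.Integrable (TreeTuning.objective tb κ F t η ρ) μ) ∧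
        (∀ (N : ℕ) (S : Fin N → TreeTuning.Dataset X n c),
          ∃ ρ : TreeTuning.Params, TreeTuning.IsERM tb κ F t η B S ρ) ∧
        ∀ (ε δ : ℝ), 0 < ε → 0 < δ →
        ∀ N : ℕ,
          K * ((1 + η * t) / ε) ^ 2 *
            (t * (Real.log F.card + Real.log t + c * Real.log (B + c)) + Real.log (1 / δ)) ≤ N →
          MeasureTheory.Measure.pi (fun _ : Fin N => μ)
            {S | ¬ ∀ ρ : TreeTuning.Params, TreeTuning.IsERM tb κ F t η B S ρ →
              ∀ ρ' : TreeTuning.Params, ρ'.Admissible B →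
                TreeTuning.risk tb κ F t η μ ρ ≤ TreeTuning.risk tb κ F t η μ ρ' + ε}
            ≤ ENNReal.ofReal δ := by
  classical
  -- `1317888 = 13 * 101376`: the logarithm of the net parameter `R ^ (13 * t)` is `13 t log R`.
  refine ⟨1317888, by norm_num, ?_⟩
  intro X _ n c t B hn hc ht hB F hF hFm tb κ hκ η hη μ _
  have hne : Nonempty (TreeTuning.Dataset X n c) := nonempty_of_isProbabilityMeasure μ
  have hcode : Measurable (TreeTuning.code F : TreeTuning.Dataset X n c → _) :=
    TreeTuning.measurable_code hFm
  set ν := μ.map (TreeTuning.code F) with hν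
  have hνp : IsProbabilityMeasure ν := Measure.isProbabilityMeasure_map hcode.aemeasurable
  -- A dataset for each code. Codes that no dataset has receive an arbitrary one, which does not
  -- affect the identities below.
  let rep := Function.invFun (TreeTuning.code F : TreeTuning.Dataset X n c → _)
  have hrep : ∀ ρ D, TreeTuning.objective tb κ F t η ρ D =
      TreeTuning.objective tb κ F t η ρ (rep (TreeTuning.code F D)) := fun ρ D =>
    (TreeTuning.indist_of_code_eq (Function.invFun_eq ⟨D, rfl⟩).symm).objective_eq hF tb κ t η ρ
  have hint : ∀ ρ, Integrable (TreeTuning.objective tb κ F t η ρ) μ := fun ρ => by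
    have : TreeTuning.objective tb κ F t η ρ =
      (fun ω => TreeTuning.objective tb κ F t η ρ (rep ω)) ∘ TreeTuning.code F :=
      funext (hrep ρ)
    rw [this]
    exact (Integrable.of_finite : Integrable _ ν).comp_measurable hcode
  have hrisk : ∀ ρ, TreeTuning.risk tb κ F t η μ ρ =
      ∫ ω, TreeTuning.objective tb κ F t η ρ (rep ω) ∂ν := fun ρ => by
    rw [hν, integral_map hcode.aemeasurable (Integrable.of_finite : Integrable _ ν).1,
      TreeTuning.risk]
    exact integral_congr_ae (.of_forall fun D => hrep ρ D)
  refine ⟨fun ρ _ => hint ρ, fun N S => TreeTuning.exists_isERM tb κ hF t η hB S, ?_⟩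
  intro ε δ hε hδ N hN
  set H : ℝ := 1 + η * t with hH
  have hH1 : 1 ≤ H := by
    have : 0 ≤ η * t := by positivity
    linarith
  have hH0 : 0 < H := by linarith
  have hIcc : ∀ ρ (D : TreeTuning.Dataset X n c), TreeTuning.objective tb κ F t η ρ D ∈ Set.Icc η (η + H) :=
    fun ρ D => TreeTuning.objective_mem_Icc tb κ hF t hη ρ D
  rcases le_total 1 δ with hδ1 | hδ1
  · exact prob_le_one.trans (by rw [← ENNReal.ofReal_one]; exact ENNReal.ofReal_le_ofReal hδ1)
  -- If `H ≤ ε`, any two risks differ by at most `ε`. Otherwise `ε / H ≤ 1`, as the uniform bound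
  -- requires.
  rcases le_total H ε with hεH | hεH
  · have hb : ∀ ρ, TreeTuning.risk tb κ F t η μ ρ ∈ Set.Icc η (η + H) := by
      intro ρ
      constructor
      · calc η = ∫ _, η ∂μ := by simp
          _ ≤ _ := integral_mono (integrable_const _) (hint ρ) fun D => (hIcc ρ D).1
      · calc TreeTuning.risk tb κ F t η μ ρ ≤ ∫ _, (η + H) ∂μ :=
              integral_mono (hint ρ) (integrable_const _) fun D => (hIcc ρ D).2
          _ = η + H := by simp
    have hempty : {S : Fin N → TreeTuning.Dataset X n c | ¬ ∀ ρ : TreeTuning.Params,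
        TreeTuning.IsERM tb κ F t η B S ρ → ∀ ρ' : TreeTuning.Params, ρ'.Admissible B →
          TreeTuning.risk tb κ F t η μ ρ ≤ TreeTuning.risk tb κ F t η μ ρ' + ε} = ∅ :=
      Set.eq_empty_of_forall_notMem fun S hS => hS fun ρ _ ρ' _ => by
        linarith [(hb ρ).2, (hb ρ').1]
    rw [hempty, measure_empty]
    exact zero_le
  obtain ⟨hR2, -⟩ := TreeTuning.breakpoint_count_le ht hF.card_pos hB hc
  set R : ℕ := t * F.card * (B + c) ^ c with hR
  have hR2' : (2 : ℝ) ≤ R := by exact_mod_cast hR2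
  have hlogR : Real.log R = Real.log F.card + Real.log t + c * Real.log (B + c) := by
    have h1 : (t : ℝ) ≠ 0 := by positivity
    have h2 : (F.card : ℝ) ≠ 0 := by exact_mod_cast hF.card_ne_zero
    have h3 : ((B : ℝ) + c) ^ c ≠ 0 := by positivity
    rw [hR]
    push_cast
    rw [Real.log_mul (mul_ne_zero h1 h2) h3, Real.log_mul h1 h2, Real.log_pow]
    ring
  have hlogR0 : 0 < Real.log R := Real.log_pos (by linarith)
  have hlogδ : 0 ≤ Real.log (1 / δ) := Real.log_nonneg (by rw [le_div_iff₀ hδ]; linarith)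
  rw [← hlogR] at hN
  have ht0 : (0 : ℝ) < t := by positivity
  have hN' : 1317888 * (t * Real.log R + Real.log (1 / δ)) ≤ N * (ε / H) ^ 2 := by
    have h1 : 1317888 * (t * Real.log R + Real.log (1 / δ)) =
        1317888 * (H / ε) ^ 2 * (t * Real.log R + Real.log (1 / δ)) * (ε / H) ^ 2 := by
      field_simp
    rw [h1]
    gcongr
  have hNpos : (0 : ℝ) < N := by
    by_contra! h
    have : (N : ℝ) = 0 := le_antisymm h N.cast_nonneg
    rw [this, zero_mul] at hN'
    have : 0 < t * Real.log R := by positivity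
    linarith
  have hM2 : (2 : ℝ) ≤ ((R ^ (13 * t) : ℕ) : ℝ) := by
    exact_mod_cast hR2.trans (Nat.le_self_pow (by omega) R)
  let g : {ρ : TreeTuning.Params // ρ.Admissible B} →
      (Fin n → ({f // f ∈ F} → Bool) × Fin c) → ℝ :=
    fun θ ω => (TreeTuning.objective tb κ F t η θ.1 (rep ω) - η) / H
  have hnets : TreeTuning.HasNets ν g ((R ^ (13 * t) : ℕ) : ℝ) :=
    TreeTuning.hasNets_objective ν rep tb hκ hF ht hB hc η fun v => (v - η) / H
  have hmain := hnets.uniform_deviation ν hM2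
    (fun θ ω => div_nonneg (sub_nonneg.2 (hIcc _ _).1) hH0.le)
    (fun θ ω => (div_le_one hH0).2 (by linarith [(hIcc θ.1 (rep ω)).2]))
    (ε := ε / H) (by positivity) ((div_le_one hH0).2 hεH) hδ hδ1 (N := N) (by
      refine le_trans ?_ hN'
      push_cast
      rw [Real.log_pow]
      push_cast
      nlinarith)
  have hpres : MeasurePreserving
      (fun (S : Fin N → TreeTuning.Dataset X n c) j => TreeTuning.code F (S j))
      (Measure.pi fun _ => μ) (Measure.pi fun _ => ν) :=
    measurePreserving_pi _ _ fun _ => ⟨hcode, rfl⟩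
  have hdev : ∀ (θ : {ρ : TreeTuning.Params // ρ.Admissible B})
      (S : Fin N → TreeTuning.Dataset X n c),
      TreeTuning.deviation ν (g θ) (fun j => TreeTuning.code F (S j)) =
        (∑ j, TreeTuning.objective tb κ F t η θ.1 (S j) -
          N * TreeTuning.risk tb κ F t η μ θ.1) / H := by
    intro θ S
    have h1 : ∫ ω, g θ ω ∂ν = (TreeTuning.risk tb κ F t η μ θ.1 - η) / H := by
      simp only [g]
      rw [integral_div, integral_sub (.of_finite) (.of_finite), hrisk]
      simp
    rw [TreeTuning.deviation, h1]
    simp only [g, ← hrep]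
    rw [← Finset.sum_div, Finset.sum_sub_distrib]
    simp only [Finset.sum_const, Finset.card_univ, Fintype.card_fin, nsmul_eq_mul]
    ring
  calc _ ≤ Measure.pi (fun _ : Fin N => μ)
        ((fun (S : Fin N → TreeTuning.Dataset X n c) j => TreeTuning.code F (S j)) ⁻¹'
          {S | ¬ ∀ θ, |TreeTuning.deviation ν (g θ) S| ≤ N * (ε / H) / 2}) := by
        refine measure_mono fun S hS hcon => hS fun ρ hρ ρ' hρ' => ?_
        have habs : ∀ θ : {ρ : TreeTuning.Params // ρ.Admissible B},
            |∑ j, TreeTuning.objective tb κ F t η θ.1 (S j) -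
              N * TreeTuning.risk tb κ F t η μ θ.1| ≤ N * ε / 2 := by
          intro θ
          have h1 := hcon θ
          rw [hdev, abs_div, abs_of_pos hH0, div_le_iff₀ hH0] at h1
          refine h1.trans_eq ?_
          field_simp
        have h1 := (abs_le.1 (habs ⟨ρ, hρ.1⟩)).1
        have h2 := (abs_le.1 (habs ⟨ρ', hρ'⟩)).2
        have h3 := hρ.2 ρ' hρ'
        -- The deviations at `ρ` and `ρ'` cost `N ε / 2` each, and the empirical comparison costs
        -- nothing.
        refine le_of_mul_le_mul_left ?_ hNpos
        dsimp only at h1 h2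
        linarith
    _ = Measure.pi (fun _ : Fin N => ν)
          {S | ¬ ∀ θ, |TreeTuning.deviation ν (g θ) S| ≤ N * (ε / H) / 2} :=
        hpres.measure_preimage (Set.toFinite _).measurableSet.nullMeasurableSet
    _ ≤ ENNReal.ofReal δ := by
        rw [← ofReal_measureReal]
        exact ENNReal.ofReal_le_ofReal hmain
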